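/- Let $\mathsf{RCA}_0^\omega$ be the classical theory in the language of all finite types (with $0$, successor, the combinators $\Pi,\Sigma$ of all types and the recursor $R_0$ with $R_0\,0\,y\,z=y$, $R_0(x+1)yz=z(R_0xyz)x$; only equality of type $0$ is primitive, equality of higher type is defined extensionally) whose axioms are the equality axioms for type $0$, full extensionality, the successor axioms, the defining equations of the constants, quantifier-free induction, and quantifier-free choice $\mathsf{QF\text{-}AC}^{1,0}$. Let $(\mu)$ be the sentence $\exists\mu^2\,\forall f^1\,(\exists x\,f(x)=0\to f(\mu(f))=0)$. Sets $X\subseteq\mathbb N$ are represented by functions of type $1$, with $n\in X$ iff $X(n)=0$; $X\cap Y$ is the pointwise maximum. A countable algebra is a sequence $\mathcal A=(A_i)_{i\in\mathbb N}$ of sets such that the collection $\{A_i\mid i\in\mathbb N\}$ is closed under complements, finite unions and finite intersections. A collection $\mathcal F\subseteq\mathcal A$ is a partial non-principal ultrafilter for $\mathcal A$ if for all $X,Y\in\mathcal A$: $X\in\mathcal F$ or $\overline X\in\mathcal F$; $X\cap Y\in\mathcal F$ implies $Y\in\mathcal F$; $X,Y\in\mathcal F$ implies $X\cap Y\in\mathcal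 F$; and every $X\in\mathcal F$ is infinite; moreover, if $\mathcal F$ is given by a characteristic functional of type $2$ (with $X\in\mathcal F$ iff $\mathcal F(X)=0$), then $\mathcal F(X)=\mathcal F(\lambda n.\min(X(n),1))$ for all $X$. It is countable if it is given as $\mathcal F=\{F_i\mid i\in\mathbb N\}$ by a sequence $(F_i)_{i\in\mathbb N}$. Then $\mathsf{RCA}_0^\omega+(\mu)$ proves: for every countable algebra $\mathcal A$, every countable partial non-principal ultrafilter $\mathcal F=(F_i)_{i\in\mathbb N}$ for $\mathcal A$ and every countable algebra $\tilde{\mathcal A}=(\tilde A_i)_{i\in\mathbb N}\supseteq\mathcal A$ there is a partial non-principal ultrafilter $\tilde{\mathcal F}\supseteq\mathcal F$ for $\tilde{\mathcal A}$, given by a characteristic functional of type $2$. Moreover, $\tilde{\mathcal F}$ can be taken of the form \[ \tilde{\mathcal F}=\mathcal F\cup\{\tilde A_i\mid b(i)=0\}, \] where $b$ is an infinite branch of the $\Pi^0_2$ tree of all finite $0/1$-sequences $x$ such that, for every $j$, there are infinitely many $z\in F_j$ with $z\in\tilde A_i\leftrightarrow x_i=0$ for all $i<\mathrm{lth}(x)$.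 -/

import Mathlib

/-!
Arithmetic in all finite types: syntax, classical natural deduction, the theory `RCA₀^ω`, the
axiom `(μ)`, and the formulas that speak about algebras of sets of natural numbers and partial
non-principal ultrafilters.

Terms and formulas are intrinsically typed, with de Bruijn variables.
-/

namespace FinTypes

/-- The finite types: `nat` is the type `0`, and `ρ ⇾ τ` is the type of functions from `ρ` to `τ`
(also written `τ(ρ)`). -/
inductive Ty : Type
  | nat : Ty
  | arr : Ty → Ty → Ty

local infixr:60 " ⇾ " => Ty.arr

/-- The type `1` of functions on the natural numbers (also used for sets of natural numbers). -/
abbrev Ty.one : Ty := Ty.nat ⇾ Ty.nat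

/-- The type `2`. -/
abbrev Ty.two : Ty := Ty.one ⇾ Ty.nat

/-- The type of sequences of sets of natural numbers. -/
abbrev Ty.seq : Ty := Ty.nat ⇾ Ty.one

/-- A context lists the types of the free variables. -/
abbrev Ctx : Type := List Ty

inductive Var : Ctx → Ty → Type
  | z {Γ : Ctx} {ρ : Ty} : Var (ρ :: Γ) ρ
  | s {Γ : Ctx} {ρ σ : Ty} : Var Γ ρ → Var (σ :: Γ) ρ

/-- Terms over `0`, the successor, the combinators `Π` and `Σ` of all types, and the recursor
`R₀` of type `0`. -/
inductive Tm (Γ : Ctx) : Ty → Type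
  | var {ρ : Ty} : Var Γ ρ → Tm Γ ρ
  | app {ρ τ : Ty} : Tm Γ (ρ ⇾ τ) → Tm Γ ρ → Tm Γ τ
  | zero : Tm Γ Ty.nat
  | succ : Tm Γ Ty.one
  | combPi (ρ τ : Ty) : Tm Γ (ρ ⇾ τ ⇾ ρ)
  | combSigma (ρ σ τ : Ty) : Tm Γ ((ρ ⇾ σ ⇾ τ) ⇾ (ρ ⇾ σ) ⇾ ρ ⇾ τ)
  | recursor : Tm Γ (Ty.nat ⇾ Ty.nat ⇾ (Ty.nat ⇾ Ty.nat ⇾ Ty.nat) ⇾ Ty.nat)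

local infixl:75 " ⬝ " => Tm.app

/-- Formulas; the only primitive relation is equality of type `0`. -/
inductive Fm : Ctx → Type
  | eq {Γ : Ctx} : Tm Γ Ty.nat → Tm Γ Ty.nat → Fm Γ
  | bot {Γ : Ctx} : Fm Γ
  | imp {Γ : Ctx} : Fm Γ → Fm Γ → Fm Γ
  | all {Γ : Ctx} (ρ : Ty) : Fm (ρ :: Γ) → Fm Γ

local infix:50 " ≐ " => Fm.eq
local infixr:30 " ⇒ " => Fm.imp

/-! ### Renaming and substitution -/

abbrev Ren (Γ Δ : Ctx) : Type := ∀ ⦃ρ : Ty⦄, Var Γ ρ → Var Δ ρ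

abbrev Sub (Γ Δ : Ctx) : Type := ∀ ⦃ρ : Ty⦄, Var Γ ρ → Tm Δ ρ

def Ren.lift {Γ Δ : Ctx} (r : Ren Γ Δ) (σ : Ty) : Ren (σ :: Γ) (σ :: Δ)
  | _, Var.z => Var.z
  | _, Var.s x => Var.s (r x)

def Tm.ren {Γ Δ : Ctx} (r : Ren Γ Δ) : {ρ : Ty} → Tm Γ ρ → Tm Δ ρ
  | _, .var x => .var (r x)
  | _, .app s t => .app (s.ren r) (t.ren r)
  | _, .zero => .zero
  | _, .succ => .succ
  | _, .combPi ρ τ => .combPi ρ τ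
  | _, .combSigma ρ σ τ => .combSigma ρ σ τ
  | _, .recursor => .recursor

/-- Weakening of a term by one new variable. -/
def Tm.up {Γ : Ctx} {σ ρ : Ty} (t : Tm Γ ρ) : Tm (σ :: Γ) ρ :=
  t.ren (fun _ x => Var.s x)

def Sub.lift {Γ Δ : Ctx} (f : Sub Γ Δ) (σ : Ty) : Sub (σ :: Γ) (σ :: Δ)
  | _, Var.z => .var Var.z
  | _, Var.s x => (f x).up

def Tm.sub {Γ Δ : Ctx} (f : Sub Γ Δ) : {ρ : Ty} → Tm Γ ρ → Tm Δ ρ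
  | _, .var x => f x
  | _, .app s t => .app (s.sub f) (t.sub f)
  | _, .zero => .zero
  | _, .succ => .succ
  | _, .combPi ρ τ => .combPi ρ τ
  | _, .combSigma ρ σ τ => .combSigma ρ σ τ
  | _, .recursor => .recursor

def Fm.ren : {Γ Δ : Ctx} → Ren Γ Δ → Fm Γ → Fm Δ
  | _, _, r, .eq s t => .eq (s.ren r) (t.ren r)
  | _, _, _, .bot => .bot
  | _, _, r, .imp A B => .imp (A.ren r) (B.ren r)
  | _, _, r, .all ρ A => .all ρ (A.ren (r.lift ρ))

def Fm.sub : {Γ Δ : Ctx} → Sub Γ Δ → Fm Γ → Fm Δ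
  | _, _, f, .eq s t => .eq (s.sub f) (t.sub f)
  | _, _, _, .bot => .bot
  | _, _, f, .imp A B => .imp (A.sub f) (B.sub f)
  | _, _, f, .all ρ A => .all ρ (A.sub (f.lift ρ))

/-- Weakening of a formula by one new variable. -/
def Fm.up {Γ : Ctx} {σ : Ty} (A : Fm Γ) : Fm (σ :: Γ) :=
  A.ren (fun _ x => Var.s x)

/-- The substitution of `t` for the last variable, the others being mapped by `f`. -/
def Sub.cons {Γ Δ : Ctx} {σ : Ty} (t : Tm Δ σ) (f : Sub Γ Δ) : Sub (σ :: Γ) Δ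
  | _, Var.z => t
  | _, Var.s x => f x

/-- `A.inst t` is `A[t]`. -/
def Fm.inst {Γ : Ctx} {σ : Ty} (A : Fm (σ :: Γ)) (t : Tm Γ σ) : Fm Γ :=
  A.sub (Sub.cons t (fun _ x => .var x))

/-! ### Derived connectives, variables, equality of higher type -/

section Abbreviations

variable {Γ : Ctx}

def Fm.neg (A : Fm Γ) : Fm Γ := A ⇒ .bot
def Fm.and (A B : Fm Γ) : Fm Γ := (A ⇒ B.neg).neg
def Fm.or (A B : Fm Γ) : Fm Γ := A.neg ⇒ B
def Fm.iff (A B : Fm Γ) : Fm Γ := (A ⇒ B).and (B ⇒ A)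
def Fm.ex (ρ : Ty) (A : Fm (ρ :: Γ)) : Fm Γ := (Fm.all ρ A.neg).neg

/-- The variables bound by the innermost quantifier, the next one, and so on. -/
def v0 {ρ : Ty} : Tm (ρ :: Γ) ρ := .var .z
def v1 {ρ σ : Ty} : Tm (σ :: ρ :: Γ) ρ := .var (.s .z)
def v2 {ρ σ τ : Ty} : Tm (τ :: σ :: ρ :: Γ) ρ := .var (.s (.s .z))
def v3 {ρ σ τ υ : Ty} : Tm (υ :: τ :: σ :: ρ :: Γ) ρ := .var (.s (.s (.s .z)))
def v4 {ρ σ τ υ φ : Ty} : Tm (φ :: υ :: τ :: σ :: ρ :: Γ) ρ := .var (.s (.s (.s (.s .z))))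

end Abbreviations

local infixr:35 " ⩓ " => Fm.and
local infixr:33 " ⩔ " => Fm.or
local infix:28 " ⇔ " => Fm.iff

/-- Equality at type `ρ`, defined extensionally: `s =_{ρ ⇾ τ} t` is `∀ x, s x =_τ t x`. -/
def Fm.eqAt : (ρ : Ty) → {Γ : Ctx} → Tm Γ ρ → Tm Γ ρ → Fm Γ
  | .nat, _, s, t => s ≐ t
  | .arr ρ τ, _, s, t => .all ρ (Fm.eqAt τ (s.up ⬝ v0) (t.up ⬝ v0))

/-- Quantifier-free formulas. -/
def Fm.QF : {Γ : Ctx} → Fm Γ → Prop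
  | _, .eq _ _ => True
  | _, .bot => True
  | _, .imp A B => A.QF ∧ B.QF
  | _, .all _ _ => False

/-! ### Classical natural deduction -/

/-- A (possibly open) formula is an axiom or not; an open axiom stands for its universal
closure. -/
abbrev Theory : Type := ∀ ⦃Γ : Ctx⦄, Fm Γ → Prop

/-- `Der T H A`: the formula `A` is derivable in many-sorted classical predicate logic from the
axioms of `T` and the open assumptions `H`. -/
inductive Der (T : Theory) : {Γ : Ctx} → List (Fm Γ) → Fm Γ → Prop
  | ax {Γ : Ctx} {H : List (Fm Γ)} {A : Fm Γ} : T A → Der T H A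
  | hyp {Γ : Ctx} {H : List (Fm Γ)} {A : Fm Γ} : A ∈ H → Der T H A
  | impI {Γ : Ctx} {H : List (Fm Γ)} {A B : Fm Γ} : Der T (A :: H) B → Der T H (A ⇒ B)
  | impE {Γ : Ctx} {H : List (Fm Γ)} {A B : Fm Γ} : Der T H (A ⇒ B) → Der T H A → Der T H B
  | raa {Γ : Ctx} {H : List (Fm Γ)} {A : Fm Γ} : Der T (A.neg :: H) .bot → Der T H A
  | allI {Γ : Ctx} {H : List (Fm Γ)} {ρ : Ty} {A : Fm (ρ :: Γ)} :
      Der T (H.map Fm.up) A → Der T H (.all ρ A)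
  | allE {Γ : Ctx} {H : List (Fm Γ)} {ρ : Ty} {A : Fm (ρ :: Γ)} :
      Der T H (.all ρ A) → (t : Tm Γ ρ) → Der T H (A.inst t)

/-- `T` proves the sentence `A`. -/
def Theory.Proves (T : Theory) (A : Fm []) : Prop := Der T [] A

/-- The theory `T` together with the sentence `B` as a further axiom. -/
inductive Theory.Plus (T : Theory) (B : Fm []) : Theory
  | old {Γ : Ctx} {A : Fm Γ} : T A → Theory.Plus T B A
  | new : Theory.Plus T B B

/-! ### The theory `RCA₀^ω` -/

/-- The axioms of `RCA₀^ω`: equality of type `0`, extensionality in all types, the successor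
axioms, the defining equations of `Π`, `Σ` and `R₀`, quantifier-free induction and
quantifier-free choice `QF-AC^{1,0}` (both with arbitrary parameters). -/
inductive RCA : Theory
  | refl {Γ : Ctx} (s : Tm Γ Ty.nat) : RCA (s ≐ s)
  | symm {Γ : Ctx} (s t : Tm Γ Ty.nat) : RCA (s ≐ t ⇒ t ≐ s)
  | trans {Γ : Ctx} (s t u : Tm Γ Ty.nat) : RCA (s ≐ t ⇒ t ≐ u ⇒ s ≐ u)
  | ext {Γ : Ctx} {ρ τ : Ty} (f : Tm Γ (ρ ⇾ τ)) (s t : Tm Γ ρ) :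
      RCA (Fm.eqAt ρ s t ⇒ Fm.eqAt τ (f ⬝ s) (f ⬝ t))
  | succ_ne_zero {Γ : Ctx} (s : Tm Γ Ty.nat) : RCA (Fm.neg (.succ ⬝ s ≐ .zero))
  | succ_inj {Γ : Ctx} (s t : Tm Γ Ty.nat) : RCA (.succ ⬝ s ≐ .succ ⬝ t ⇒ s ≐ t)
  | combPi {Γ : Ctx} {ρ τ : Ty} (s : Tm Γ ρ) (t : Tm Γ τ) :
      RCA (Fm.eqAt ρ (.combPi ρ τ ⬝ s ⬝ t) s)
  | combSigma {Γ : Ctx} {ρ σ τ : Ty} (s : Tm Γ (ρ ⇾ σ ⇾ τ)) (t : Tm Γ (ρ ⇾ σ)) (u : Tm Γ ρ) :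
      RCA (Fm.eqAt τ (.combSigma ρ σ τ ⬝ s ⬝ t ⬝ u) (s ⬝ u ⬝ (t ⬝ u)))
  | rec_zero {Γ : Ctx} (y : Tm Γ Ty.nat) (z : Tm Γ (Ty.nat ⇾ Ty.nat ⇾ Ty.nat)) :
      RCA (.recursor ⬝ .zero ⬝ y ⬝ z ≐ y)
  | rec_succ {Γ : Ctx} (x y : Tm Γ Ty.nat) (z : Tm Γ (Ty.nat ⇾ Ty.nat ⇾ Ty.nat)) :
      RCA (.recursor ⬝ (.succ ⬝ x) ⬝ y ⬝ z ≐ z ⬝ (.recursor ⬝ x ⬝ y ⬝ z) ⬝ x)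
  /-- `A(0) → ∀ x (A(x) → A(x + 1)) → ∀ x A(x)` -/
  | induction {Γ : Ctx} (A : Fm (Ty.nat :: Γ)) : A.QF →
      RCA (A.inst .zero ⇒
        .all Ty.nat (A ⇒ A.sub (Sub.cons (.succ ⬝ v0) (fun _ x => .var (.s x)))) ⇒
        .all Ty.nat A)
  /-- `∀ f ∃ x A(f, x) → ∃ F ∀ f A(f, F f)` -/
  | choice {Γ : Ctx} (A : Fm (Ty.nat :: Ty.one :: Γ)) : A.QF →
      RCA (.all Ty.one (.ex Ty.nat A) ⇒
        .ex Ty.two (.all Ty.one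
          (A.sub (Sub.cons (v1 ⬝ v0) (Sub.cons v0 (fun _ x => .var (.s (.s x))))))))

/-- `(μ)`: there is `μ` of type `2` such that `f (μ f) = 0` whenever `∃ x, f x = 0`. -/
def muAxiom : Fm [] :=
  .ex Ty.two (.all Ty.one
    (.ex Ty.nat (v1 ⬝ v0 ≐ .zero) ⇒ v0 ⬝ (v1 ⬝ v0) ≐ .zero))

/-! ### Lambda abstraction and some primitive recursive functions -/

/-- Lambda abstraction, by means of the combinators. -/
def Tm.lam {Γ : Ctx} {ρ : Ty} : {τ : Ty} → Tm (ρ :: Γ) τ → Tm Γ (ρ ⇾ τ)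
  | _, .var .z => .combSigma ρ (ρ ⇾ ρ) ρ ⬝ .combPi ρ (ρ ⇾ ρ) ⬝ .combPi ρ ρ
  | _, .var (.s x) => .combPi _ ρ ⬝ .var x
  | _, .app s t => .combSigma ρ _ _ ⬝ s.lam ⬝ t.lam
  | _, .zero => .combPi _ ρ ⬝ .zero
  | _, .succ => .combPi _ ρ ⬝ .succ
  | _, .combPi σ τ => .combPi _ ρ ⬝ .combPi σ τ
  | _, .combSigma σ τ υ => .combPi _ ρ ⬝ .combSigma σ τ υ
  | _, .recursor => .combPi _ ρ ⬝ .recursor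

section Arithmetic

variable {Γ : Ctx}

def Tm.add (s t : Tm Γ Ty.nat) : Tm Γ Ty.nat :=
  .recursor ⬝ t ⬝ s ⬝ Tm.lam (Tm.lam (.succ ⬝ v1))

def Tm.pred (s : Tm Γ Ty.nat) : Tm Γ Ty.nat :=
  .recursor ⬝ s ⬝ .zero ⬝ Tm.lam (Tm.lam v0)

/-- Truncated subtraction. -/
def Tm.monus (s t : Tm Γ Ty.nat) : Tm Γ Ty.nat :=
  .recursor ⬝ t ⬝ s ⬝ Tm.lam (Tm.lam (Tm.pred v1))

def Tm.max (s t : Tm Γ Ty.nat) : Tm Γ Ty.nat := s.add (t.monus s)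
def Tm.min (s t : Tm Γ Ty.nat) : Tm Γ Ty.nat := s.monus (s.monus t)
def Tm.num1 : Tm Γ Ty.nat := .succ ⬝ .zero

/-- `s < t` -/
def Fm.lt (s t : Tm Γ Ty.nat) : Fm Γ := Tm.monus (.succ ⬝ s) t ≐ .zero

/-! ### Sets of natural numbers -/

/-- `s ∈ X`, where `X` is viewed as a characteristic function: `X s = 0`. -/
def Fm.elt (s : Tm Γ Ty.nat) (X : Tm Γ Ty.one) : Fm Γ := X ⬝ s ≐ .zero

def Tm.inter (X Y : Tm Γ Ty.one) : Tm Γ Ty.one := Tm.lam (Tm.max (X.up ⬝ v0) (Y.up ⬝ v0))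
def Tm.union (X Y : Tm Γ Ty.one) : Tm Γ Ty.one := Tm.lam (Tm.min (X.up ⬝ v0) (Y.up ⬝ v0))
def Tm.compl (X : Tm Γ Ty.one) : Tm Γ Ty.one := Tm.lam (Tm.monus Tm.num1 (X.up ⬝ v0))

/-- `λ n. min (X n) 1` -/
def Tm.normalize (X : Tm Γ Ty.one) : Tm Γ Ty.one := Tm.lam (Tm.min (X.up ⬝ v0) Tm.num1)

/-- `X` and `Y` are the same set. -/
def Fm.setEq (X Y : Tm Γ Ty.one) : Fm Γ := .all Ty.nat (.elt v0 X.up ⇔ .elt v0 Y.up)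

/-- `∀ n ∃ k > n, k ∈ X` -/
def Fm.infinite (X : Tm Γ Ty.one) : Fm Γ :=
  .all Ty.nat (.ex Ty.nat (Fm.lt v1 v0 ⩓ .elt v0 X.up.up))

end Arithmetic

/-- A collection of sets of natural numbers: either the countable collection enumerated by a
sequence of sets, or the collection given by a characteristic functional of type `2`. -/
inductive Coll (Γ : Ctx) : Type
  | enum : Tm Γ Ty.seq → Coll Γ
  | char : Tm Γ Ty.two → Coll Γ

def Coll.up {Γ : Ctx} {σ : Ty} : Coll Γ → Coll (σ :: Γ)
  | .enum A => .enum A.up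
  | .char U => .char U.up

/-- `X` is a member of the collection: `∃ i, X = A_i`, respectively `U X = 0`. -/
def Fm.mem {Γ : Ctx} (X : Tm Γ Ty.one) : Coll Γ → Fm Γ
  | .enum A => .ex Ty.nat (.setEq X.up (A.up ⬝ v0))
  | .char U => U ⬝ X ≐ .zero

section Ultrafilters

variable {Γ : Ctx}

def Fm.subColl (C D : Coll Γ) : Fm Γ := .all Ty.one (.mem v0 C.up ⇒ .mem v0 D.up)

/-- `C` is closed under complements, unions and intersections. -/
def Fm.algebra (C : Coll Γ) : Fm Γ :=
  .all Ty.one (.mem v0 C.up ⇒ .mem (Tm.compl v0) C.up) ⩓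
  .all Ty.one (.all Ty.one
    (.mem v1 C.up.up ⩓ .mem v0 C.up.up ⇒ .mem (Tm.union v1 v0) C.up.up)) ⩓
  .all Ty.one (.all Ty.one
    (.mem v1 C.up.up ⩓ .mem v0 C.up.up ⇒ .mem (Tm.inter v1 v0) C.up.up))

/-- Membership depends only on the set, not on its characteristic function. For a characteristic
functional this is `∀ X, U X = U (λ n. min (X n) 1)`. -/
def Fm.wellDefined : Coll Γ → Fm Γ
  | .enum A => .all Ty.one (.mem v0 (.enum A.up) ⇔ .mem (Tm.normalize v0) (.enum A.up))
  | .char U => .all Ty.one (U.up ⬝ v0 ≐ U.up ⬝ Tm.normalize v0)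

/-- `F` is a partial non-principal ultrafilter for `C`. -/
def Fm.partialUltrafilter (C F : Coll Γ) : Fm Γ :=
  .subColl F C ⩓
  .all Ty.one (.mem v0 C.up ⇒ .mem v0 F.up ⩔ .mem (Tm.compl v0) F.up) ⩓
  .all Ty.one (.all Ty.one (.mem v1 C.up.up ⩓ .mem v0 C.up.up ⇒
    .mem (Tm.inter v1 v0) F.up.up ⇒ .mem v0 F.up.up)) ⩓
  .all Ty.one (.all Ty.one (.mem v1 C.up.up ⩓ .mem v0 C.up.up ⇒
    .mem v1 F.up.up ⩓ .mem v0 F.up.up ⇒ .mem (Tm.inter v1 v0) F.up.up)) ⩓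
  .all Ty.one (.mem v0 C.up ⇒ .mem v0 F.up ⇒ .infinite v0) ⩓
  .wellDefined F

/-- `b` is an infinite branch of the tree of all 0/1-sequences `x` such that for every `j` the
set `A^x ∩ F_j` is infinite, where `A^x` is the intersection over `i < lth x` of `A_i` (if
`x_i = 0`) and of the complement of `A_i` (if `x_i = 1`):
`b` is 0/1-valued, and for all `n`, `j`, `y` there is `z > y` with `z ∈ F_j` and
`z ∈ A_i ↔ b i = 0` for all `i < n`. -/
def Fm.branch (A F : Tm Γ Ty.seq) (b : Tm Γ Ty.one) : Fm Γ :=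
  .all Ty.nat (b.up ⬝ v0 ≐ .zero ⩔ b.up ⬝ v0 ≐ Tm.num1) ⩓
  .all Ty.nat (.all Ty.nat (.all Ty.nat (.ex Ty.nat
    (Fm.lt v1 v0 ⩓ .elt v0 (F.up.up.up.up ⬝ v2) ⩓
      .all Ty.nat (Fm.lt v0 v4 ⇒
        (.elt v1 (A.up.up.up.up.up ⬝ v0) ⇔ b.up.up.up.up.up ⬝ v0 ≐ .zero))))))

/-- `U = {F_j | j ∈ ℕ} ∪ {A_i | b i = 0}` -/
def Fm.generated (A F : Tm Γ Ty.seq) (b : Tm Γ Ty.one) (U : Tm Γ Ty.two) : Fm Γ :=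
  .all Ty.one (.mem v0 (.char U.up) ⇔
    .mem v0 (.enum F.up) ⩔
    .ex Ty.nat (b.up.up ⬝ v0 ≐ .zero ⩓ .setEq v1 (A.up.up ⬝ v0)))

end Ultrafilters

/-- For all sequences `A`, `F` such that `A` is an algebra and `F` a partial non-principal
ultrafilter for `A`, and for every sequence `B` that is an algebra extending `A`, there are `b`
and `U` such that `U` is a partial non-principal ultrafilter for `B` extending `F`, and moreover
`b` is a branch of the tree given by `B` and `F`, and `U = F ∪ {B_i | b i = 0}`. -/
def extensionSentence : Fm [] :=
  .all Ty.seq (.all Ty.seq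
    (.algebra (.enum v1) ⩓ .partialUltrafilter (.enum v1) (.enum v0) ⇒
      .all Ty.seq (.algebra (.enum v0) ⩓ .subColl (.enum v2) (.enum v0) ⇒
        .ex Ty.one (.ex Ty.two
          (.partialUltrafilter (.enum v2) (.char v0) ⩓
            .subColl (.enum v3) (.char v0) ⩓
            .branch v2 v3 v1 ⩓
            .generated v2 v3 v1 v0)))))

end FinTypes

/-! By completeness (`der_of_models`) it suffices to argue in an arbitrary extensional model of
`RCA` satisfying (μ). Completeness is Henkin's construction: each stage adds one fresh variable and
assumes either a universal formula or the negation of its matrix at that variable. The eventually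
derivable formulas form a complete theory with witnesses, and its terms modulo extensional equality
are the model. The extensionality axioms make this relation a congruence, so in the model equality
of higher type is genuine equality.

In such a model (μ) turns a number quantifier into an equation. Hence every arithmetical predicate,
with parameters of any type, has a characteristic functional (`DfnP.ex`, `Str.exists_char`), which
yields arithmetical comprehension, induction and choice.

The tree has no dead ends because F is closed under intersections. If both extensions of a node
failed, one on some F_j beyond y and the other on some F_j' beyond y', then an element of F_j ∩ F_j'
beyond both bounds that realizes the node would realize neither extension (`Str.Node.exists_succ`).
A node is coded by a number realizing it, so a branch arises by iterating a choice of successors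
with the recursor of type 0 alone (`Str.exists_branch`).

Along the branch b, any finitely many B_i with the signs prescribed by b are realized simultaneously
by infinitely many elements of each F_j. So B_i belongs to F ∪ {B_i | b i = 0} exactly when b i = 0,
whichever index presents the set, and each ultrafilter law is read off from one element realizing
the signs of the sets involved (`Str.sat_extensionSentence`). The union is arithmetical, hence has a
characteristic functional. -/

namespace FinTypes

local infixr:60 " ⇾ " => Ty.arr
local infixl:75 " ⬝ " => Tm.app
local infix:50 " ≐ " => Fm.eq
local infixr:30 " ⇒ " => Fm.imp

/-! ### Substitution lemmas -/

/-- The substitution that replaces each variable by itself. -/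
abbrev Sub.id (Γ : Ctx) : Sub Γ Γ := fun _ x => .var x

/-- The substitution that renames variables. -/
abbrev Sub.ofRen {Γ Δ : Ctx} (r : Ren Γ Δ) : Sub Γ Δ := fun _ x => .var (r x)

/-- The weakening substitution. -/
abbrev Sub.shift (Γ : Ctx) (σ : Ty) : Sub Γ (σ :: Γ) := fun _ x => .var (.s x)

/-- First `f`, then `g`. -/
def Sub.comp {Γ Δ Θ : Ctx} (f : Sub Γ Δ) (g : Sub Δ Θ) : Sub Γ Θ := fun _ x => (f x).sub g

theorem Sub.ext_cons {Γ Δ : Ctx} {σ : Ty} {f g : Sub (σ :: Γ) Δ} (hz : f Var.z = g Var.z)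
    (hs : ∀ ⦃ρ : Ty⦄ (x : Var Γ ρ), f (Var.s x) = g (Var.s x)) : f = g := by
  funext ρ x
  cases x with
  | z => exact hz
  | s x => exact hs x

theorem Tm.ren_eq_sub {Γ Δ : Ctx} (r : Ren Γ Δ) {ρ : Ty} (t : Tm Γ ρ) :
    t.ren r = t.sub (Sub.ofRen r) := by
  induction t <;> simp_all [Tm.ren, Tm.sub]

theorem Tm.up_eq_sub {Γ : Ctx} {σ ρ : Ty} (t : Tm Γ ρ) :
    (t.up : Tm (σ :: Γ) ρ) = t.sub (Sub.shift Γ σ) := Tm.ren_eq_sub _ t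

theorem Tm.sub_sub {Γ Δ Θ : Ctx} (f : Sub Γ Δ) (g : Sub Δ Θ) {ρ : Ty} (t : Tm Γ ρ) :
    (t.sub f).sub g = t.sub (f.comp g) := by
  induction t <;> simp_all [Tm.sub, Sub.comp]

@[simp] theorem Tm.sub_id {Γ : Ctx} {ρ : Ty} (t : Tm Γ ρ) : t.sub (Sub.id Γ) = t := by
  induction t <;> simp_all [Tm.sub]

theorem Sub.lift_ofRen {Γ Δ : Ctx} (r : Ren Γ Δ) (σ : Ty) :
    (Sub.ofRen r).lift σ = Sub.ofRen (r.lift σ) :=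
  Sub.ext_cons rfl (fun _ _ => rfl)

theorem Sub.lift_id (Γ : Ctx) (σ : Ty) : (Sub.id Γ).lift σ = Sub.id (σ :: Γ) :=
  Sub.ext_cons rfl (fun _ _ => rfl)

theorem Sub.shift_comp_lift {Γ Δ : Ctx} (f : Sub Γ Δ) (σ : Ty) :
    (Sub.shift Γ σ).comp (f.lift σ) = f.comp (Sub.shift Δ σ) := by
  funext ρ x
  exact Tm.up_eq_sub _

theorem Sub.lift_comp_lift {Γ Δ Θ : Ctx} (f : Sub Γ Δ) (g : Sub Δ Θ) (σ : Ty) :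
    (f.lift σ).comp (g.lift σ) = (f.comp g).lift σ := by
  refine Sub.ext_cons rfl (fun ρ x => ?_)
  change (f x).up.sub (g.lift σ) = ((f x).sub g).up
  rw [Tm.up_eq_sub, Tm.up_eq_sub, Tm.sub_sub, Tm.sub_sub, Sub.shift_comp_lift]

theorem Fm.ren_eq_sub {Γ Δ : Ctx} (r : Ren Γ Δ) (A : Fm Γ) :
    A.ren r = A.sub (Sub.ofRen r) := by
  induction A generalizing Δ with
  | eq s t => simp [Fm.ren, Fm.sub, Tm.ren_eq_sub]
  | bot => rfl
  | imp A B hA hB => simp [Fm.ren, Fm.sub, hA, hB]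
  | all ρ A hA => simp [Fm.ren, Fm.sub, hA, Sub.lift_ofRen]

theorem Fm.up_eq_sub {Γ : Ctx} {σ : Ty} (A : Fm Γ) :
    (A.up : Fm (σ :: Γ)) = A.sub (Sub.shift Γ σ) := Fm.ren_eq_sub _ A

theorem Fm.sub_sub {Γ Δ Θ : Ctx} (f : Sub Γ Δ) (g : Sub Δ Θ) (A : Fm Γ) :
    (A.sub f).sub g = A.sub (f.comp g) := by
  induction A generalizing Δ Θ with
  | eq s t => simp [Fm.sub, Tm.sub_sub]
  | bot => rfl
  | imp A B hA hB => simp [Fm.sub, hA, hB]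
  | all ρ A hA => simp [Fm.sub, hA, Sub.lift_comp_lift]

@[simp] theorem Fm.sub_id {Γ : Ctx} (A : Fm Γ) : A.sub (Sub.id Γ) = A := by
  induction A with
  | eq s t => simp [Fm.sub]
  | bot => rfl
  | imp A B hA hB => simp [Fm.sub, hA, hB]
  | all ρ A hA => simp [Fm.sub, Sub.lift_id, hA]

theorem Fm.up_sub_lift {Γ Δ : Ctx} (f : Sub Γ Δ) (σ : Ty) (A : Fm Γ) :
    A.up.sub (f.lift σ) = (A.sub f).up := by
  rw [Fm.up_eq_sub, Fm.up_eq_sub, Fm.sub_sub, Fm.sub_sub, Sub.shift_comp_lift]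

theorem Sub.shift_comp_cons {Γ Δ : Ctx} {σ : Ty} (t : Tm Δ σ) (f : Sub Γ Δ) :
    (Sub.shift Γ σ).comp (Sub.cons t f) = f := rfl

theorem Tm.up_sub_cons {Γ Δ : Ctx} {σ ρ : Ty} (t : Tm Δ σ) (f : Sub Γ Δ) (s : Tm Γ ρ) :
    s.up.sub (Sub.cons t f) = s.sub f := by
  rw [Tm.up_eq_sub, Tm.sub_sub, Sub.shift_comp_cons]

theorem Fm.up_inst {Γ : Ctx} {σ : Ty} (A : Fm Γ) (t : Tm Γ σ) : A.up.inst t = A := by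
  rw [Fm.up_eq_sub, Fm.inst, Fm.sub_sub, Sub.shift_comp_cons, Fm.sub_id]

theorem Sub.lift_comp_cons {Γ Δ Θ : Ctx} {σ : Ty} (f : Sub Γ Δ) (t : Tm Θ σ) (g : Sub Δ Θ) :
    (f.lift σ).comp (Sub.cons t g) = Sub.cons t (f.comp g) :=
  Sub.ext_cons rfl (fun _ x => Tm.up_sub_cons t g (f x))

theorem Sub.cons_comp {Γ Δ Θ : Ctx} {σ : Ty} (t : Tm Δ σ) (f : Sub Γ Δ) (g : Sub Δ Θ) :
    (Sub.cons t f).comp g = Sub.cons (t.sub g) (f.comp g) :=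
  Sub.ext_cons rfl (fun _ _ => rfl)

theorem Sub.comp_id {Γ Δ : Ctx} (f : Sub Γ Δ) : f.comp (Sub.id Δ) = f := by
  funext ρ x
  exact Tm.sub_id _

theorem Sub.id_comp {Γ Δ : Ctx} (f : Sub Γ Δ) : (Sub.id Γ).comp f = f := rfl

theorem Fm.sub_lift_inst {Γ Δ : Ctx} {σ : Ty} (f : Sub Γ Δ) (A : Fm (σ :: Γ)) (t : Tm Δ σ) :
    (A.sub (f.lift σ)).inst t = A.sub (Sub.cons t f) := by
  rw [Fm.inst, Fm.sub_sub, Sub.lift_comp_cons, Sub.comp_id]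

theorem Fm.inst_sub {Γ Δ : Ctx} {σ : Ty} (f : Sub Γ Δ) (A : Fm (σ :: Γ)) (t : Tm Γ σ) :
    (A.inst t).sub f = (A.sub (f.lift σ)).inst (t.sub f) := by
  rw [Fm.sub_lift_inst, Fm.inst, Fm.sub_sub, Sub.cons_comp, Sub.id_comp]

theorem Fm.lift_shift_inst {Γ : Ctx} {σ : Ty} (A : Fm (σ :: Γ)) :
    (A.sub ((Sub.shift Γ σ).lift σ)).inst (.var .z) = A := by
  rw [Fm.sub_lift_inst]
  convert Fm.sub_id A
  exact Sub.ext_cons rfl (fun _ _ => rfl)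

theorem Fm.eqAt_sub {Γ Δ : Ctx} (f : Sub Γ Δ) (ρ : Ty) (s t : Tm Γ ρ) :
    (Fm.eqAt ρ s t).sub f = Fm.eqAt ρ (s.sub f) (t.sub f) := by
  induction ρ generalizing Γ Δ with
  | nat => rfl
  | arr ρ τ _ ih =>
    simp only [Fm.eqAt, Fm.sub, ih, Tm.sub, Tm.up_eq_sub, Tm.sub_sub, Sub.shift_comp_lift]
    rfl

theorem Fm.QF.sub {Γ Δ : Ctx} (f : Sub Γ Δ) {A : Fm Γ} (h : A.QF) : (A.sub f).QF := by
  induction A generalizing Δ with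
  | eq s t => trivial
  | bot => trivial
  | imp A B hA hB => exact ⟨hA f h.1, hB f h.2⟩
  | all ρ A hA => exact h.elim

/-! ### Theories closed under substitution -/

/-- Every substitution instance of an axiom is an axiom. -/
def Theory.SubClosed (T : Theory) : Prop :=
  ∀ ⦃Γ Δ : Ctx⦄ (f : Sub Γ Δ) (A : Fm Γ), T A → T (A.sub f)

/-- Every axiom is a schema with parameters in an arbitrary context. Only induction and choice need
work, since their conclusions contain substitution instances that must commute with the given
substitution. -/
theorem RCA.subClosed : Theory.SubClosed RCA := by
  intro Γ Δ f A h
  cases h with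
  | refl s => exact RCA.refl _
  | symm s t => exact RCA.symm _ _
  | trans s t u => exact RCA.trans _ _ _
  | ext g s t =>
    simp only [Fm.sub, Fm.eqAt_sub, Tm.sub]
    exact RCA.ext _ _ _
  | succ_ne_zero s => exact RCA.succ_ne_zero _
  | succ_inj s t => exact RCA.succ_inj _ _
  | combPi s t =>
    simp only [Fm.eqAt_sub, Tm.sub]
    exact RCA.combPi _ _
  | combSigma s t u =>
    simp only [Fm.eqAt_sub, Tm.sub]
    exact RCA.combSigma _ _ _
  | rec_zero y z => exact RCA.rec_zero _ _
  | rec_succ x y z => exact RCA.rec_succ _ _ _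
  | induction A hA =>
    have h := RCA.induction (A.sub (f.lift Ty.nat)) (hA.sub _)
    simp only [Fm.sub, Fm.inst_sub]
    convert h using 4
    · rfl
    rw [Fm.sub_sub, Fm.sub_sub, Sub.lift_comp_cons, Sub.cons_comp]
    refine congrArg (fun g => Fm.imp _ (Fm.sub g A)) ?_
    refine Sub.ext_cons rfl (fun ρ x => ?_)
    exact Tm.up_eq_sub (f x)
  | choice A hA =>
    have h := RCA.choice (A.sub ((f.lift Ty.one).lift Ty.nat)) (hA.sub _)
    simp only [Fm.sub, Fm.ex, Fm.neg] at h ⊢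
    convert h using 6
    rw [Fm.sub_sub, Fm.sub_sub, Sub.lift_comp_cons, Sub.cons_comp, Sub.cons_comp,
      Sub.lift_comp_cons]
    refine congrArg (fun g => Fm.sub g A) ?_
    refine Sub.ext_cons rfl (fun ρ x => ?_)
    cases x with
    | z => rfl
    | s x =>
      change (f x).up.up = (f x).sub _
      rw [Tm.up_eq_sub, Tm.up_eq_sub, Tm.sub_sub]
      rfl

/-! ### Admissible rules -/

section Rules

variable {T : Theory}

theorem Der.weaken {Γ : Ctx} {H K : List (Fm Γ)} {A : Fm Γ} (h : Der T H A) (hHK : H ⊆ K) :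
    Der T K A := by
  induction h with
  | ax h => exact .ax h
  | hyp h => exact .hyp (hHK h)
  | impI _ ih => exact .impI (ih (List.cons_subset_cons _ hHK))
  | impE _ _ ih₁ ih₂ => exact .impE (ih₁ hHK) (ih₂ hHK)
  | raa _ ih => exact .raa (ih (List.cons_subset_cons _ hHK))
  | allI _ ih => exact .allI (ih (List.map_subset _ hHK))
  | allE _ t ih => exact .allE (ih hHK) t

/-- This carries derivations from one Henkin stage to the next, where the context has grown. -/
theorem Der.sub (hT : T.SubClosed) {Γ Δ : Ctx} {H : List (Fm Γ)} {A : Fm Γ} (h : Der T H A)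
    (f : Sub Γ Δ) : Der T (H.map (Fm.sub f)) (A.sub f) := by
  induction h generalizing Δ with
  | ax h => exact .ax (hT f _ h)
  | hyp h => exact .hyp (List.mem_map_of_mem h)
  | impI _ ih => exact .impI (ih f)
  | impE _ _ ih₁ ih₂ => exact .impE (ih₁ f) (ih₂ f)
  | raa _ ih => exact .raa (ih f)
  | @allI Γ H ρ A _ ih =>
    refine .allI ?_
    have := ih (f.lift ρ)
    rw [List.map_map] at this ⊢
    convert this using 2
    funext B
    exact (Fm.up_sub_lift f ρ B).symm
  | allE _ t ih =>
    rw [Fm.inst_sub]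
    exact .allE (ih f) _

theorem Der.exfalso {Γ : Ctx} {H : List (Fm Γ)} {A : Fm Γ} (h : Der T H .bot) : Der T H A :=
  .raa (h.weaken (List.subset_cons_self _ _))

end Rules

/-- A term of each type. -/
def Tm.default {Γ : Ctx} : (ρ : Ty) → Tm Γ ρ
  | .nat => .zero
  | .arr _ τ => .combPi _ _ ⬝ Tm.default τ

/-! ### Countability of the syntax -/

def Ty.code : Ty → ℕ
  | .nat => 0
  | .arr ρ τ => Nat.pair ρ.code τ.code + 1

theorem Ty.code_injective : Function.Injective Ty.code := by
  intro ρ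
  induction ρ with
  | nat => intro σ h; cases σ <;> simp_all [Ty.code]
  | arr ρ τ ihρ ihτ =>
    intro σ h
    cases σ with
    | nat => simp [Ty.code] at h
    | arr ρ' τ' =>
      simp only [Ty.code, Nat.add_right_cancel_iff, Nat.pair_eq_pair] at h
      rw [ihρ h.1, ihτ h.2]

instance : Countable Ty := Ty.code_injective.countable

def Var.code {Γ : Ctx} {ρ : Ty} : Var Γ ρ → ℕ
  | .z => 0
  | .s x => x.code + 1

theorem Var.code_injective {Γ : Ctx} {ρ ρ' : Ty} (x : Var Γ ρ) (y : Var Γ ρ')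
    (h : x.code = y.code) : (⟨ρ, x⟩ : Σ ρ, Var Γ ρ) = ⟨ρ', y⟩ := by
  induction x with
  | z =>
    cases y with
    | z => rfl
    | s y => simp [Var.code] at h
  | s x ih =>
    cases y with
    | z => simp [Var.code] at h
    | s y =>
      simp only [Var.code, Nat.add_right_cancel_iff] at h
      cases ih y h
      rfl

def Tm.code {Γ : Ctx} {ρ : Ty} : Tm Γ ρ → ℕ
  | .var x => Nat.pair 0 x.code
  | .app s t => Nat.pair 1 (Nat.pair s.code t.code)
  | .zero => Nat.pair 2 0
  | .succ => Nat.pair 3 0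
  | .combPi ρ τ => Nat.pair 4 (Nat.pair ρ.code τ.code)
  | .combSigma ρ σ τ => Nat.pair 5 (Nat.pair ρ.code (Nat.pair σ.code τ.code))
  | .recursor => Nat.pair 6 0

/-- The type of the argument cannot be read off from the type of an application, so the induction
must recover the type together with the term. -/
theorem Tm.code_injective {Γ : Ctx} {ρ ρ' : Ty} (s : Tm Γ ρ) (t : Tm Γ ρ')
    (h : s.code = t.code) : (⟨ρ, s⟩ : Σ ρ, Tm Γ ρ) = ⟨ρ', t⟩ := by
  induction s generalizing ρ' with
  | var x =>
    cases t <;> simp only [Tm.code, Nat.pair_eq_pair] at h <;> try omega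
    cases Var.code_injective _ _ h.2
    rfl
  | app s₁ s₂ ih₁ ih₂ =>
    cases t <;> simp only [Tm.code, Nat.pair_eq_pair] at h <;> try omega
    cases ih₁ _ h.2.1
    cases ih₂ _ h.2.2
    rfl
  | zero => cases t <;> simp only [Tm.code, Nat.pair_eq_pair] at h <;> first | omega | rfl
  | succ => cases t <;> simp only [Tm.code, Nat.pair_eq_pair] at h <;> first | omega | rfl
  | combPi ρ τ =>
    cases t <;> simp only [Tm.code, Nat.pair_eq_pair] at h <;> try omega
    cases Ty.code_injective h.2.1
    cases Ty.code_injective h.2.2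
    rfl
  | combSigma ρ σ τ =>
    cases t <;> simp only [Tm.code, Nat.pair_eq_pair] at h <;> try omega
    cases Ty.code_injective h.2.1
    cases Ty.code_injective h.2.2.1
    cases Ty.code_injective h.2.2.2
    rfl
  | recursor => cases t <;> simp only [Tm.code, Nat.pair_eq_pair] at h <;> first | omega | rfl

def Fm.code {Γ : Ctx} : Fm Γ → ℕ
  | .eq s t => Nat.pair 0 (Nat.pair s.code t.code)
  | .bot => Nat.pair 1 0
  | .imp A B => Nat.pair 2 (Nat.pair A.code B.code)
  | .all ρ A => Nat.pair 3 (Nat.pair ρ.code A.code)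

theorem Fm.code_injective {Γ : Ctx} : Function.Injective (Fm.code (Γ := Γ)) := by
  intro A
  induction A with
  | eq s t =>
    intro B h
    cases B <;> simp only [Fm.code, Nat.pair_eq_pair] at h <;> try omega
    cases Tm.code_injective _ _ h.2.1
    cases Tm.code_injective _ _ h.2.2
    rfl
  | bot => intro B h; cases B <;> simp only [Fm.code, Nat.pair_eq_pair] at h <;> first | omega | rfl
  | imp A₁ A₂ ih₁ ih₂ =>
    intro B h
    cases B <;> simp only [Fm.code, Nat.pair_eq_pair] at h <;> try omega
    rw [ih₁ h.2.1, ih₂ h.2.2]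
  | all ρ A ih =>
    intro B h
    cases B <;> simp only [Fm.code, Nat.pair_eq_pair] at h <;> try omega
    cases Ty.code_injective h.2.1
    rw [ih h.2.2]

instance {Γ : Ctx} : Countable (Fm Γ) := Fm.code_injective.countable

/-! ### Structures -/

/-- A structure for the language of finite types. -/
structure Str where
  C : Ty → Type
  app : {ρ τ : Ty} → C (ρ ⇾ τ) → C ρ → C τ
  zero : C Ty.nat
  succ : C Ty.one
  combPi (ρ τ : Ty) : C (ρ ⇾ τ ⇾ ρ)
  combSigma (ρ σ τ : Ty) : C ((ρ ⇾ σ ⇾ τ) ⇾ (ρ ⇾ σ) ⇾ ρ ⇾ τ)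
  recursor : C (Ty.nat ⇾ Ty.nat ⇾ (Ty.nat ⇾ Ty.nat ⇾ Ty.nat) ⇾ Ty.nat)

/-- Assignments of elements to the variables of a context. -/
abbrev Str.Env (M : Str) (Γ : Ctx) : Type := ∀ ⦃ρ : Ty⦄, Var Γ ρ → M.C ρ

def Str.Env.nil {M : Str} : M.Env [] := fun _ x => nomatch x

def Str.Env.cons {M : Str} {Γ : Ctx} {σ : Ty} (a : M.C σ) (e : M.Env Γ) : M.Env (σ :: Γ)
  | _, Var.z => a
  | _, Var.s x => e x

def Tm.eval {M : Str} {Γ : Ctx} (e : M.Env Γ) : {ρ : Ty} → Tm Γ ρ → M.C ρ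
  | _, .var x => e x
  | _, .app s t => M.app (s.eval e) (t.eval e)
  | _, .zero => M.zero
  | _, .succ => M.succ
  | _, .combPi ρ τ => M.combPi ρ τ
  | _, .combSigma ρ σ τ => M.combSigma ρ σ τ
  | _, .recursor => M.recursor

def Fm.Sat {M : Str} : {Γ : Ctx} → Fm Γ → M.Env Γ → Prop
  | _, .eq s t, e => s.eval e = t.eval e
  | _, .bot, _ => False
  | _, .imp A B, e => A.Sat e → B.Sat e
  | _, .all _ A, e => ∀ a, A.Sat (Str.Env.cons a e)

/-- Equality of functions is extensional. -/
def Str.Ext (M : Str) : Prop :=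
  ∀ ⦃ρ τ : Ty⦄ (f g : M.C (ρ ⇾ τ)), (∀ x, M.app f x = M.app g x) → f = g

/-- All axioms of `T` hold under all assignments. -/
def Str.Models (M : Str) (T : Theory) : Prop :=
  ∀ ⦃Γ : Ctx⦄ (A : Fm Γ), T A → ∀ e : M.Env Γ, A.Sat e

/-- The axioms for equality of type `0` and extensionality. -/
structure Theory.HasEq (T : Theory) : Prop where
  refl : ∀ ⦃Γ : Ctx⦄ (s : Tm Γ Ty.nat), T (s ≐ s)
  symm : ∀ ⦃Γ : Ctx⦄ (s t : Tm Γ Ty.nat), T (s ≐ t ⇒ t ≐ s)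
  trans : ∀ ⦃Γ : Ctx⦄ (s t u : Tm Γ Ty.nat), T (s ≐ t ⇒ t ≐ u ⇒ s ≐ u)
  ext : ∀ ⦃Γ : Ctx⦄ ⦃ρ τ : Ty⦄ (f : Tm Γ (ρ ⇾ τ)) (s t : Tm Γ ρ),
    T (Fm.eqAt ρ s t ⇒ Fm.eqAt τ (f ⬝ s) (f ⬝ t))

/-! ### The Henkin construction -/

namespace Henkin

open Filter

/-- A stage, a context, and a formula with one more variable in that context. -/
abbrev Task : Type := ℕ × Σ Γ : Ctx, Σ ρ : Ty, Fm (ρ :: Γ)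

instance : Inhabited Task := ⟨0, [], Ty.nat, .bot⟩

theorem exists_schedule : ∃ E : ℕ → Task, ∀ x N, ∃ n, N ≤ n ∧ E n = x := by
  obtain ⟨f, hf⟩ := exists_surjective_nat Task
  refine ⟨fun n => f n.unpair.1, fun x N => ?_⟩
  obtain ⟨k, rfl⟩ := hf x
  -- Only the first component selects the task; the second is free and pushes the index beyond any
  -- bound.
  exact ⟨Nat.pair k N, Nat.right_le_pair k N, by simp⟩

/-- An enumeration of all tasks in which every task occurs infinitely often. -/
noncomputable def schedule : ℕ → Task := exists_schedule.choose

theorem schedule_frequently (x : Task) (N : ℕ) : ∃ n, N ≤ n ∧ schedule n = x :=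
  exists_schedule.choose_spec x N

/-- The type of the variable added at stage `n`. -/
noncomputable def newTy (n : ℕ) : Ty := (schedule n).2.2.1

/-- The context at stage `n`. -/
noncomputable def ctx : ℕ → Ctx
  | 0 => []
  | n + 1 => newTy n :: ctx n

/-- The inclusion of the context at stage `n` into the one at stage `n + 1`. -/
noncomputable def next (n : ℕ) : Sub (ctx n) (ctx (n + 1)) := Sub.shift (ctx n) (newTy n)

open Classical in
/-- The formula treated at stage `n`, if the task is `x`. -/
noncomputable def target (n : ℕ) (x : Task) : Fm (x.2.2.1 :: ctx n) :=
  -- A task whose stage lies ahead, or whose formula is not over the context of its stage, is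
  -- replaced by the dummy `.bot`.
  if h : x.1 ≤ n ∧ x.2.1 = ctx x.1 then
    Nat.leRecOn (C := fun k => Fm (x.2.2.1 :: ctx k)) h.1
      (fun {k} B => B.sub ((next k).lift x.2.2.1)) (h.2 ▸ x.2.2.2)
  else .bot

variable (T : Theory) (H₀ : List (Fm []))

open Classical in
/-- The assumptions made up to stage `n`. -/
noncomputable def hyps : (n : ℕ) → List (Fm (ctx n))
  | 0 => H₀
  | n + 1 =>
    -- One step both decides the universal formula and supplies a witness: if it is refutable, the
    -- variable just added becomes a counterexample; otherwise it is assumed.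
    if Der T (Fm.all _ (target n (schedule n)) :: hyps n) .bot then
      (target n (schedule n)).neg :: (hyps n).map (Fm.sub (next n))
    else (Fm.all _ (target n (schedule n)) :: hyps n).map (Fm.sub (next n))

variable {T H₀}

theorem map_sub_next {n : ℕ} (H : List (Fm (ctx n))) :
    H.map (Fm.sub (next n)) = H.map (Fm.up (σ := newTy n)) := by
  refine List.map_congr_left (fun A _ => ?_)
  rw [Fm.up_eq_sub]
  rfl

theorem sub_next_consistent {n : ℕ} {H : List (Fm (ctx n))}
    (h : ¬ Der T H .bot) : ¬ Der T (H.map (Fm.sub (next n))) .bot := by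
  intro h'
  rw [map_sub_next] at h'
  -- All types are inhabited by closed terms, so a fresh variable can be generalized and
  -- instantiated away.
  exact h (Der.allE (A := .bot) (.allI h') (Tm.default _))

/-- If a fresh counterexample led to a contradiction, the matrix would be derivable for a generic
variable. Then so would be the universal formula, which is refutable in this case. -/
theorem hyps_consistent (h₀ : ¬ Der T H₀ .bot) (n : ℕ) : ¬ Der T (hyps T H₀ n) .bot := by
  induction n with
  | zero => exact h₀
  | succ n ih =>
    rw [hyps]
    split_ifs with h
    · intro h'
      rw [map_sub_next] at h'
      exact ih (.impE (.impI h) (.allI (.raa h')))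
    · exact sub_next_consistent h

theorem hyps_next (n : ℕ) : (hyps T H₀ n).map (Fm.sub (next n)) ⊆ hyps T H₀ (n + 1) := by
  rw [hyps]
  split_ifs
  · exact List.subset_cons_self _ _
  · exact List.map_subset _ (List.subset_cons_self _ _)

theorem der_succ (hT : T.SubClosed) {n : ℕ} {A : Fm (ctx n)} (h : Der T (hyps T H₀ n) A) :
    Der T (hyps T H₀ (n + 1)) (A.sub (next n)) :=
  (h.sub hT (next n)).weaken (hyps_next n)

variable (T H₀) in
/-- `A` is eventually derivable. -/
def Holds (A : ∀ n, Fm (ctx n)) : Prop :=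
  ∀ᶠ n in atTop, Der T (hyps T H₀ n) (A n)

/-- A sequence of formulas that is eventually constant up to weakening. -/
def Stable (A : ∀ n, Fm (ctx n)) : Prop := ∀ᶠ n in atTop, A (n + 1) = (A n).sub (next n)

/-- A sequence of formulas with one distinguished variable that is eventually constant up to
weakening. -/
def StableUnder {ρ : Ty} (B : ∀ n, Fm (ρ :: ctx n)) : Prop :=
  ∀ᶠ n in atTop, B (n + 1) = (B n).sub ((next n).lift ρ)

/-- Terms over the union of all contexts. -/
structure Elt (ρ : Ty) : Type where
  tm : ∀ n, Tm (ctx n) ρ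
  stable : ∀ᶠ n in atTop, tm (n + 1) = (tm n).sub (next n)

theorem exists_elt {ρ : Ty} (N : ℕ) (t : Tm (ctx N) ρ) :
    ∃ x : Elt ρ, x.tm N = t ∧ ∀ n, N ≤ n → x.tm (n + 1) = (x.tm n).sub (next n) := by
  classical
  let u : ∀ n, Tm (ctx n) ρ := fun n => if h : N ≤ n then
    Nat.leRecOn (C := fun k => Tm (ctx k) ρ) h (fun {k} s => s.sub (next k)) t else Tm.default ρ
  have hu : ∀ n, N ≤ n → u (n + 1) = (u n).sub (next n) := by
    intro n hn
    simp only [u, dif_pos hn, dif_pos (Nat.le_succ_of_le hn)]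
    rw [Nat.leRecOn_succ hn]
  refine ⟨⟨u, eventually_atTop.2 ⟨N, hu⟩⟩, ?_, hu⟩
  simp only [u, dif_pos le_rfl]
  exact Nat.leRecOn_self _

theorem holds_of_der (hT : T.SubClosed) {A : ∀ n, Fm (ctx n)} {N : ℕ}
    (hA : ∀ n, N ≤ n → A (n + 1) = (A n).sub (next n)) (h : Der T (hyps T H₀ N) (A N)) :
    Holds T H₀ A := by
  refine eventually_atTop.2 ⟨N, fun n hn => ?_⟩
  induction n, hn using Nat.le_induction with
  | base => exact h
  | succ n hn ih => rw [hA n hn]; exact der_succ hT ih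

theorem target_eq {ρ : Ty} {B : ∀ n, Fm (ρ :: ctx n)} {N n : ℕ} (hNn : N ≤ n)
    (hB : ∀ n, N ≤ n → B (n + 1) = (B n).sub ((next n).lift ρ)) :
    target n ⟨N, ctx N, ρ, B N⟩ = B n := by
  have key : ∀ m (h : N ≤ m), Nat.leRecOn (C := fun k => Fm (ρ :: ctx k)) h
      (fun {k} B => B.sub ((next k).lift ρ)) (B N) = B m := by
    intro m h
    induction m, h using Nat.le_induction with
    | base => exact Nat.leRecOn_self _
    | succ m hm ih => rw [Nat.leRecOn_succ hm, ih, hB m hm]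
  rw [← key n hNn]
  simp [target, hNn]

theorem hyps_succ_decides (n : ℕ) :
    Der T (hyps T H₀ (n + 1)) ((Fm.all _ (target n (schedule n))).sub (next n)) ∨
    ∃ t, Der T (hyps T H₀ (n + 1))
      (((target n (schedule n)).sub ((next n).lift _)).inst t).neg := by
  rw [hyps]
  split_ifs with h
  · refine Or.inr ⟨(.var .z : Tm (newTy n :: ctx n) (newTy n)), .hyp ?_⟩
    have : ((target n (schedule n)).sub ((next n).lift _)).inst
        (.var .z : Tm (newTy n :: ctx n) (newTy n)) = target n (schedule n) :=
      Fm.lift_shift_inst (σ := newTy n) (target n (schedule n))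
    rw [this]
    exact List.mem_cons_self
  · exact Or.inl (.hyp (List.mem_cons_self))

/-- Eventually, a universal formula is derivable or it has a counterexample. -/
theorem holds_all_or (hT : T.SubClosed) {ρ : Ty} {B : ∀ n, Fm (ρ :: ctx n)}
    (hB : StableUnder B) : Holds T H₀ (fun n => .all ρ (B n)) ∨
      ∃ x : Elt ρ, Holds T H₀ (fun n => ((B n).inst (x.tm n)).neg) := by
  obtain ⟨N, hN⟩ := eventually_atTop.1 hB
  -- The formula is posted as it stands at stage `N`, from which on `B` changes only by weakening;
  -- when the task comes up at stage `n`, the formula treated is `B n`.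
  obtain ⟨n, hn, hs⟩ := schedule_frequently ⟨N, ctx N, ρ, B N⟩ N
  have hN' : ∀ m, n + 1 ≤ m → B (m + 1) = (B m).sub ((next m).lift ρ) :=
    fun m hm => hN m (by omega)
  have h := hyps_succ_decides (T := T) (H₀ := H₀) n
  rw [hs, target_eq hn hN] at h
  rcases h with h | ⟨t, h⟩
  · refine Or.inl (holds_of_der hT (N := n + 1) (fun m hm => ?_) ?_)
    · rw [hN' m hm]; rfl
    · rw [hN n hn]; exact h
  · obtain ⟨x, hx, hx'⟩ := exists_elt (n + 1) t
    refine Or.inr ⟨x, holds_of_der hT (N := n + 1) (fun m hm => ?_) ?_⟩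
    · rw [hN' m hm, hx' m hm, ← Fm.inst_sub]; rfl
    · rw [hN n hn, hx]; exact h

theorem not_holds_neg (h₀ : ¬ Der T H₀ .bot) {A : ∀ n, Fm (ctx n)} (h : Holds T H₀ A) :
    ¬ Holds T H₀ (fun n => (A n).neg) := by
  intro h'
  obtain ⟨n, h₁, h₂⟩ := (h.and h').exists
  exact hyps_consistent h₀ n (.impE h₂ h₁)

theorem holds_all_iff (hT : T.SubClosed) (h₀ : ¬ Der T H₀ .bot) {ρ : Ty}
    {B : ∀ n, Fm (ρ :: ctx n)} (hB : StableUnder B) :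
    Holds T H₀ (fun n => .all ρ (B n)) ↔
      ∀ x : Elt ρ, Holds T H₀ (fun n => (B n).inst (x.tm n)) := by
  constructor
  · intro h x
    exact h.mono (fun n hn => .allE hn _)
  · intro h
    refine (holds_all_or hT hB).resolve_right ?_
    rintro ⟨x, hx⟩
    exact not_holds_neg h₀ (h x) hx

/-- Completeness of the limit theory is the dichotomy for universal formulas, applied to a vacuous
quantifier. -/
theorem holds_or_neg (hT : T.SubClosed) {A : ∀ n, Fm (ctx n)} (hA : Stable A) :
    Holds T H₀ A ∨ Holds T H₀ (fun n => (A n).neg) := by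
  have hB : StableUnder (fun n => (A n).up (σ := Ty.nat)) :=
    hA.mono (fun n hn => by beta_reduce; rw [hn, Fm.up_sub_lift])
  rcases holds_all_or hT hB (H₀ := H₀) with h | ⟨x, h⟩
  · refine Or.inl (h.mono (fun n hn => ?_))
    have := hn.allE .zero
    rwa [Fm.up_inst] at this
  · refine Or.inr (h.mono (fun n hn => ?_))
    simpa only [Fm.up_inst] using hn

theorem holds_imp_iff (hT : T.SubClosed) {A B : ∀ n, Fm (ctx n)}
    (hA : Stable A) :
    Holds T H₀ (fun n => A n ⇒ B n) ↔ (Holds T H₀ A → Holds T H₀ B) := by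
  constructor
  · intro h h'
    exact (h.and h').mono (fun n hn => .impE hn.1 hn.2)
  · intro h
    rcases holds_or_neg hT hA (H₀ := H₀) with h' | h'
    · exact (h h').mono (fun n hn => .impI (hn.weaken (List.subset_cons_self _ _)))
    · refine h'.mono (fun n hn => .impI (Der.exfalso ?_))
      exact .impE (hn.weaken (List.subset_cons_self _ _)) (.hyp List.mem_cons_self)

/-! ### The term model -/

namespace Elt

def app {ρ τ : Ty} (f : Elt (ρ ⇾ τ)) (x : Elt ρ) : Elt τ where
  tm n := f.tm n ⬝ x.tm n
  stable := (f.stable.and x.stable).mono (fun n hn => by rw [hn.1, hn.2]; rfl)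

variable (T H₀) in
/-- Extensional equality. -/
def Eqv : (ρ : Ty) → Elt ρ → Elt ρ → Prop
  | .nat, x, y => Holds T H₀ (fun n => x.tm n ≐ y.tm n)
  | .arr _ τ, f, g => ∀ x, Eqv τ (f.app x) (g.app x)

theorem stableUnder_eqAt {ρ τ : Ty} (f g : Elt (ρ ⇾ τ)) :
    StableUnder (fun n => Fm.eqAt τ ((f.tm n).up ⬝ v0) ((g.tm n).up ⬝ v0)) := by
  refine (f.stable.and g.stable).mono (fun n hn => ?_)
  beta_reduce
  rw [hn.1, hn.2]
  simp only [Fm.eqAt_sub, Tm.sub, Tm.up_eq_sub, Tm.sub_sub, Sub.shift_comp_lift]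
  rfl

/-- The witnesses let quantification over elements match the quantifiers in the defined equality.
This makes the extensionality axiom applicable to the semantic relation. -/
theorem eqv_iff (hT : T.SubClosed) (h₀ : ¬ Der T H₀ .bot) {ρ : Ty} (x y : Elt ρ) :
    Eqv T H₀ ρ x y ↔ Holds T H₀ (fun n => Fm.eqAt ρ (x.tm n) (y.tm n)) := by
  induction ρ with
  | nat => rfl
  | arr ρ τ _ ih =>
    simp only [Eqv, Fm.eqAt]
    rw [holds_all_iff hT h₀ (stableUnder_eqAt x y)]
    refine forall_congr' (fun z => ?_)
    rw [ih]
    simp only [Fm.inst, Fm.eqAt_sub, Tm.sub, Tm.up_sub_cons, Tm.sub_id]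
    rfl

theorem eqv_equivalence (hE : T.HasEq) (ρ : Ty) : Equivalence (Eqv T H₀ ρ) := by
  induction ρ with
  | nat =>
    refine ⟨fun x => ?_, fun {x y} h => ?_, fun {x y z} h h' => ?_⟩
    · exact Eventually.of_forall (fun n => .ax (hE.refl _))
    · exact h.mono (fun n hn => .impE (.ax (hE.symm _ _)) hn)
    · exact (h.and h').mono (fun n hn => .impE (.impE (.ax (hE.trans _ _ _)) hn.1) hn.2)
  | arr ρ τ _ ih =>
    exact ⟨fun f x => ih.refl _, fun h x => ih.symm (h x), fun h h' x => ih.trans (h x) (h' x)⟩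

theorem eqv_app (hT : T.SubClosed) (hE : T.HasEq) (h₀ : ¬ Der T H₀ .bot) {ρ τ : Ty}
    {f g : Elt (ρ ⇾ τ)} (hfg : Eqv T H₀ _ f g) {x y : Elt ρ} (hxy : Eqv T H₀ _ x y) :
    Eqv T H₀ _ (f.app x) (g.app y) := by
  refine (eqv_equivalence hE τ).trans ?_ (hfg y)
  rw [eqv_iff hT h₀] at hxy ⊢
  exact hxy.mono (fun n hn => .impE (.ax (hE.ext _ _ _)) hn)

def setoid (hE : T.HasEq) (H₀ : List (Fm [])) (ρ : Ty) : Setoid (Elt ρ) :=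
  ⟨Eqv T H₀ ρ, eqv_equivalence hE ρ⟩

/-- The elements denoted by a closed term that is the same at all stages. -/
noncomputable def const {ρ : Ty} (t : ∀ Γ, Tm Γ ρ)
    (ht : ∀ Γ Δ (f : Sub Γ Δ), (t Γ).sub f = t Δ) : Elt ρ :=
  ⟨fun n => t (ctx n), Eventually.of_forall (fun n => (ht _ _ (next n)).symm)⟩

end Elt

section TermModel

variable (hT : T.SubClosed) (hE : T.HasEq) (h₀ : ¬ Der T H₀ .bot)

/-- The quotient of the terms by extensional equality. -/
noncomputable def termModel : Str where
  C ρ := Quotient (Elt.setoid hE H₀ ρ)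
  app := Quotient.map₂ Elt.app (fun _ _ h _ _ h' => Elt.eqv_app hT hE h₀ h h')
  zero := Quotient.mk _ (.const (fun _ => .zero) (fun _ _ _ => rfl))
  succ := Quotient.mk _ (.const (fun _ => .succ) (fun _ _ _ => rfl))
  combPi ρ τ := Quotient.mk _ (.const (fun _ => .combPi ρ τ) (fun _ _ _ => rfl))
  combSigma ρ σ τ := Quotient.mk _ (.const (fun _ => .combSigma ρ σ τ) (fun _ _ _ => rfl))
  recursor := Quotient.mk _ (.const (fun _ => .recursor) (fun _ _ _ => rfl))

theorem termModel_ext : (termModel hT hE h₀).Ext := by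
  intro ρ τ f g
  induction f using Quotient.inductionOn with | h f => ?_
  induction g using Quotient.inductionOn with | h g => ?_
  intro h
  exact Quotient.sound (fun x => Quotient.exact (h (Quotient.mk _ x)))

/-- The substitution at stage `n` that is given by an assignment of terms. -/
def stageSub {Γ : Ctx} (e : ∀ ⦃ρ : Ty⦄, Var Γ ρ → Elt ρ) (n : ℕ) : Sub Γ (ctx n) :=
  fun _ x => (e x).tm n

theorem stageSub_stable {Γ : Ctx} (e : ∀ ⦃ρ : Ty⦄, Var Γ ρ → Elt ρ) :
    ∀ᶠ n in atTop, stageSub e (n + 1) = (stageSub e n).comp (next n) := by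
  induction Γ with
  | nil => exact Eventually.of_forall (fun n => by funext ρ x; cases x)
  | cons σ Γ ih =>
    filter_upwards [(e Var.z).stable, ih (fun ρ x => e (Var.s x))] with n hz hs
    exact Sub.ext_cons hz (fun ρ x => congrFun (congrFun hs ρ) x)

def nilElt : ∀ ⦃ρ : Ty⦄, Var [] ρ → Elt ρ := fun _ x => nomatch x

def consElt {Γ : Ctx} {σ : Ty} (a : Elt σ) (e : ∀ ⦃ρ : Ty⦄, Var Γ ρ → Elt ρ) :
    ∀ ⦃ρ : Ty⦄, Var (σ :: Γ) ρ → Elt ρ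
  | _, .z => a
  | _, .s x => e x

theorem stageSub_consElt {Γ : Ctx} {σ : Ty} (a : Elt σ) (e : ∀ ⦃ρ : Ty⦄, Var Γ ρ → Elt ρ)
    (n : ℕ) : stageSub (consElt a e) n = Sub.cons (a.tm n) (stageSub e n) :=
  Sub.ext_cons rfl (fun _ _ => rfl)

/-- The assignment of classes given by an assignment of terms. -/
def mkEnv {Γ : Ctx} (e : ∀ ⦃ρ : Ty⦄, Var Γ ρ → Elt ρ) : (termModel hT hE h₀).Env Γ :=
  fun _ x => Quotient.mk _ (e x)

theorem mkEnv_consElt {Γ : Ctx} {σ : Ty} (a : Elt σ) (e : ∀ ⦃ρ : Ty⦄, Var Γ ρ → Elt ρ) :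
    mkEnv hT hE h₀ (consElt a e) =
      Str.Env.cons (M := termModel hT hE h₀) (Quotient.mk _ a) (mkEnv hT hE h₀ e) := by
  funext ρ x
  cases x <;> rfl

noncomputable def Elt.ofTm {Γ : Ctx} (e : ∀ ⦃ρ : Ty⦄, Var Γ ρ → Elt ρ) {ρ : Ty}
    (t : Tm Γ ρ) : Elt ρ :=
  ⟨fun n => t.sub (stageSub e n), (stageSub_stable e).mono (fun n hn => by
    rw [hn, Tm.sub_sub])⟩

theorem eval_mkEnv {Γ : Ctx} (e : ∀ ⦃ρ : Ty⦄, Var Γ ρ → Elt ρ) {ρ : Ty} (t : Tm Γ ρ) :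
    t.eval (mkEnv hT hE h₀ e) = Quotient.mk _ (Elt.ofTm e t) := by
  induction t with
  | app s t ihs iht => rw [Tm.eval, ihs, iht]; rfl
  | _ => rfl

/-- The truth lemma: implication uses completeness of the limit theory, and quantification uses its
witnesses. -/
theorem sat_mkEnv {Γ : Ctx} (A : Fm Γ) (e : ∀ ⦃ρ : Ty⦄, Var Γ ρ → Elt ρ) :
    A.Sat (mkEnv hT hE h₀ e) ↔ Holds T H₀ (fun n => A.sub (stageSub e n)) := by
  induction A with
  | eq s t =>
    rw [Fm.Sat, eval_mkEnv, eval_mkEnv]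
    exact Quotient.eq (r := Elt.setoid hE H₀ Ty.nat)
  | bot =>
    refine iff_of_false id (fun h => ?_)
    obtain ⟨n, hn⟩ := h.exists
    exact hyps_consistent h₀ n hn
  | imp A B ihA ihB =>
    rw [Fm.Sat, ihA, ihB]
    refine (holds_imp_iff hT ?_).symm
    exact (stageSub_stable e).mono (fun n hn => by beta_reduce; rw [hn, Fm.sub_sub])
  | all ρ A ih =>
    have hB : StableUnder (fun n => A.sub ((stageSub e n).lift ρ)) :=
      (stageSub_stable e).mono (fun n hn => by beta_reduce; rw [hn, Fm.sub_sub, Sub.lift_comp_lift])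
    refine Iff.trans ?_ (holds_all_iff hT h₀ hB).symm
    simp only [Fm.sub_lift_inst]
    constructor
    · intro h x
      have := (ih (consElt x e)).1 (by rw [mkEnv_consElt]; exact h _)
      simpa only [stageSub_consElt] using this
    · intro h a
      induction a using Quotient.inductionOn with | h x => ?_
      have := (ih (consElt x e)).2 (by simpa only [stageSub_consElt] using h x)
      rwa [mkEnv_consElt] at this

end TermModel

end Henkin

/-! ### Completeness for extensional models -/

/-- A consistent set of assumptions has an extensional model. -/
theorem exists_model {T : Theory} (hT : T.SubClosed) (hE : T.HasEq) {H : List (Fm [])}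
    (h₀ : ¬ Der T H .bot) :
    ∃ M : Str, M.Ext ∧ M.Models T ∧ ∀ A ∈ H, A.Sat (Str.Env.nil (M := M)) := by
  refine ⟨Henkin.termModel hT hE h₀, Henkin.termModel_ext hT hE h₀, ?_, ?_⟩
  · intro Γ A hA e
    have he : e = Henkin.mkEnv hT hE h₀ (fun ρ x => Quotient.out (e x)) := by
      funext ρ x
      exact (Quotient.out_eq (e x)).symm
    rw [he, Henkin.sat_mkEnv]
    exact Filter.Eventually.of_forall (fun n => .ax (hT _ _ hA))
  · intro A hA
    have he : Str.Env.nil (M := Henkin.termModel hT hE h₀) =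
        Henkin.mkEnv hT hE h₀ Henkin.nilElt := by
      funext ρ x
      cases x
    rw [he, Henkin.sat_mkEnv]
    refine Henkin.holds_of_der hT (N := 0) (fun n _ => ?_) ?_
    · rw [Fm.sub_sub]
      congr 1
      funext ρ x
      cases x
    · have hid : Henkin.stageSub Henkin.nilElt 0 = Sub.id [] := by
        funext ρ x
        cases x
      have : A.sub (Henkin.stageSub Henkin.nilElt 0) = A :=
        (congrArg (fun f : Sub [] [] => A.sub f) hid).trans (Fm.sub_id A)
      rw [this]
      exact .hyp hA

/-- Completeness: what holds in all extensional models is derivable. -/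
theorem der_of_models {T : Theory} (hT : T.SubClosed) (hE : T.HasEq) {H : List (Fm [])}
    {A : Fm []} (h : ∀ M : Str, M.Ext → M.Models T →
      (∀ B ∈ H, B.Sat (Str.Env.nil (M := M))) → A.Sat (Str.Env.nil (M := M))) :
    Der T H A := by
  refine .raa (by_contra fun hc => ?_)
  obtain ⟨M, hM, hMT, hMH⟩ := exists_model hT hE hc
  exact hMH A.neg List.mem_cons_self
    (h M hM hMT (fun B hB => hMH B (List.mem_cons_of_mem _ hB)))

local infixl:75 " ⋄ " => Str.app _

/-! ### Semantics of the derived notions -/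

section Semantics

variable {M : Str} {Γ : Ctx}

theorem Tm.eval_sub {Δ : Ctx} (f : Sub Γ Δ) (e : M.Env Δ) {ρ : Ty} (t : Tm Γ ρ) :
    (t.sub f).eval e = t.eval (fun _ x => (f x).eval e) := by
  induction t <;> simp_all [Tm.sub, Tm.eval]

@[simp] theorem Tm.eval_up {σ ρ : Ty} (a : M.C σ) (e : M.Env Γ) (t : Tm Γ ρ) :
    t.up.eval (Str.Env.cons a e) = t.eval e := by
  rw [Tm.up_eq_sub, Tm.eval_sub]
  rfl

@[simp] theorem Fm.sat_eq (s t : Tm Γ Ty.nat) (e : M.Env Γ) :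
    (s ≐ t).Sat e ↔ s.eval e = t.eval e := Iff.rfl

@[simp] theorem Fm.sat_imp (A B : Fm Γ) (e : M.Env Γ) :
    (A ⇒ B).Sat e ↔ (A.Sat e → B.Sat e) := Iff.rfl

@[simp] theorem Fm.sat_all {ρ : Ty} (A : Fm (ρ :: Γ)) (e : M.Env Γ) :
    (Fm.all ρ A).Sat e ↔ ∀ a, A.Sat (Str.Env.cons a e) := Iff.rfl

@[simp] theorem Fm.sat_neg (A : Fm Γ) (e : M.Env Γ) : A.neg.Sat e ↔ ¬ A.Sat e := Iff.rfl

@[simp] theorem Fm.sat_and (A B : Fm Γ) (e : M.Env Γ) :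
    (A.and B).Sat e ↔ A.Sat e ∧ B.Sat e := by
  simp only [Fm.and, Fm.sat_neg, Fm.sat_imp]
  tauto

@[simp] theorem Fm.sat_or (A B : Fm Γ) (e : M.Env Γ) :
    (A.or B).Sat e ↔ A.Sat e ∨ B.Sat e := by
  simp only [Fm.or, Fm.sat_neg, Fm.sat_imp]
  tauto

@[simp] theorem Fm.sat_iff (A B : Fm Γ) (e : M.Env Γ) :
    (A.iff B).Sat e ↔ (A.Sat e ↔ B.Sat e) := by
  simp only [Fm.iff, Fm.sat_and, Fm.sat_imp]
  tauto

@[simp] theorem Fm.sat_ex {ρ : Ty} (A : Fm (ρ :: Γ)) (e : M.Env Γ) :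
    (Fm.ex ρ A).Sat e ↔ ∃ a, A.Sat (Str.Env.cons a e) := by
  simp [Fm.ex]

@[simp] theorem Tm.eval_app {ρ τ : Ty} (s : Tm Γ (ρ ⇾ τ)) (t : Tm Γ ρ) (e : M.Env Γ) :
    (s ⬝ t).eval e = s.eval e ⋄ t.eval e := rfl

@[simp] theorem Tm.eval_zero (e : M.Env Γ) : (Tm.zero : Tm Γ _).eval e = M.zero := rfl

@[simp] theorem Tm.eval_succ (e : M.Env Γ) : (Tm.succ : Tm Γ _).eval e = M.succ := rfl

@[simp] theorem eval_v0 {ρ : Ty} (a : M.C ρ) (e : M.Env Γ) :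
    (v0 : Tm (ρ :: Γ) ρ).eval (Str.Env.cons a e) = a := rfl

@[simp] theorem eval_v1 {ρ σ : Ty} (a : M.C ρ) (b : M.C σ) (e : M.Env Γ) :
    (v1 : Tm (σ :: ρ :: Γ) ρ).eval (.cons b (.cons a e)) = a := rfl

@[simp] theorem eval_v2 {ρ σ τ : Ty} (a : M.C ρ) (b : M.C σ) (c : M.C τ) (e : M.Env Γ) :
    (v2 : Tm (τ :: σ :: ρ :: Γ) ρ).eval (.cons c (.cons b (.cons a e))) = a := rfl

@[simp] theorem eval_v3 {ρ σ τ υ : Ty} (a : M.C ρ) (b : M.C σ) (c : M.C τ) (d : M.C υ)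
    (e : M.Env Γ) :
    (v3 : Tm (υ :: τ :: σ :: ρ :: Γ) ρ).eval (.cons d (.cons c (.cons b (.cons a e)))) = a := rfl

@[simp] theorem eval_v4 {ρ σ τ υ φ : Ty} (a : M.C ρ) (b : M.C σ) (c : M.C τ) (d : M.C υ)
    (d' : M.C φ) (e : M.Env Γ) :
    (v4 : Tm (φ :: υ :: τ :: σ :: ρ :: Γ) ρ).eval
      (.cons d' (.cons d (.cons c (.cons b (.cons a e))))) = a := rfl

theorem Fm.sat_eqAt (hM : M.Ext) {ρ : Ty} (s t : Tm Γ ρ) (e : M.Env Γ) :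
    (Fm.eqAt ρ s t).Sat e ↔ s.eval e = t.eval e := by
  induction ρ generalizing Γ with
  | nat => rfl
  | arr ρ τ _ ih =>
    simp only [Fm.eqAt, Fm.sat_all, ih, Tm.eval_app, Tm.eval_up, eval_v0]
    exact ⟨hM _ _, fun h a => by rw [h]⟩

end Semantics

/-! ### The axioms read in a model -/

/-- Extensional models of `RCA₀^ω + (μ)`. -/
class Str.IsMuModel (M : Str) : Prop where
  ext : M.Ext
  rca : M.Models RCA
  mu : muAxiom.Sat (Str.Env.nil (M := M))

namespace Str

variable (M : Str) [M.IsMuModel]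

/-- The number `1`. -/
abbrev one : M.C Ty.nat := M.succ ⋄ M.zero

variable {M}

theorem app_ext {ρ τ : Ty} {f g : M.C (ρ ⇾ τ)} (h : ∀ x, f ⋄ x = g ⋄ x) : f = g :=
  IsMuModel.ext f g h

@[simp] theorem combPi_app {ρ τ : Ty} (a : M.C ρ) (b : M.C τ) : M.combPi ρ τ ⋄ a ⋄ b = a :=
  (Fm.sat_eqAt IsMuModel.ext _ _ _).1
    (IsMuModel.rca _ (RCA.combPi v0 v1) (.cons a (.cons b .nil)))

@[simp] theorem combSigma_app {ρ σ τ : Ty} (a : M.C (ρ ⇾ σ ⇾ τ)) (b : M.C (ρ ⇾ σ)) (c : M.C ρ) :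
    M.combSigma ρ σ τ ⋄ a ⋄ b ⋄ c = a ⋄ c ⋄ (b ⋄ c) :=
  (Fm.sat_eqAt IsMuModel.ext _ _ _).1
    (IsMuModel.rca _ (RCA.combSigma v0 v1 v2) (.cons a (.cons b (.cons c .nil))))

@[simp] theorem recursor_zero (y : M.C Ty.nat) (z : M.C (Ty.nat ⇾ Ty.nat ⇾ Ty.nat)) :
    M.recursor ⋄ M.zero ⋄ y ⋄ z = y :=
  IsMuModel.rca _ (RCA.rec_zero v0 v1) (.cons y (.cons z .nil))

@[simp] theorem recursor_succ (x y : M.C Ty.nat) (z : M.C (Ty.nat ⇾ Ty.nat ⇾ Ty.nat)) :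
    M.recursor ⋄ (M.succ ⋄ x) ⋄ y ⋄ z = z ⋄ (M.recursor ⋄ x ⋄ y ⋄ z) ⋄ x :=
  IsMuModel.rca _ (RCA.rec_succ v0 v1 v2) (.cons x (.cons y (.cons z .nil)))

@[simp] theorem succ_ne_zero (x : M.C Ty.nat) : M.succ ⋄ x ≠ M.zero :=
  IsMuModel.rca _ (RCA.succ_ne_zero v0) (.cons x .nil)

@[simp] theorem succ_inj {x y : M.C Ty.nat} : M.succ ⋄ x = M.succ ⋄ y ↔ x = y :=
  ⟨IsMuModel.rca _ (RCA.succ_inj v0 v1) (.cons x (.cons y .nil)), fun h => by rw [h]⟩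

theorem induction_app (f : M.C Ty.one) (hz : f ⋄ M.zero = M.zero)
    (hs : ∀ x, f ⋄ x = M.zero → f ⋄ (M.succ ⋄ x) = M.zero) (x : M.C Ty.nat) :
    f ⋄ x = M.zero :=
  IsMuModel.rca _ (RCA.induction (Γ := [Ty.one]) (v1 ⬝ v0 ≐ .zero) trivial) (.cons f .nil)
    hz hs x

/-- Equality of numbers is decided by a functional. -/
theorem exists_eq_decider : ∃ d : M.C Ty.two, ∀ f : M.C Ty.one,
    (f ⋄ M.zero = f ⋄ M.one → d ⋄ f = M.zero) ∧
    (f ⋄ M.zero ≠ f ⋄ M.one → d ⋄ f = M.one) := by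
  -- The choice schema has a function as its input, so the two numbers to be compared are passed as
  -- the values of one function at 0 and 1.
  let E : Fm [Ty.nat, Ty.one] := v1 ⬝ .zero ≐ v1 ⬝ (.succ ⬝ .zero)
  let A : Fm [Ty.nat, Ty.one] :=
    Fm.and (E ⇒ v0 ≐ .zero) (E.neg ⇒ v0 ≐ .succ ⬝ .zero)
  have h := IsMuModel.rca (M := M) _ (RCA.choice A (by simp [A, E, Fm.and, Fm.neg, Fm.QF])) .nil
  have h' := h (by
    intro f
    rw [Fm.sat_ex]
    by_cases hf : f ⋄ M.zero = f ⋄ M.one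
    · refine ⟨M.zero, ?_⟩
      simp only [A, E, Fm.sat_and, Fm.sat_imp, Fm.sat_eq, Fm.sat_neg]
      exact ⟨fun _ => rfl, fun h => (h hf).elim⟩
    · refine ⟨M.one, ?_⟩
      simp only [A, E, Fm.sat_and, Fm.sat_imp, Fm.sat_eq, Fm.sat_neg]
      exact ⟨fun h => (hf h).elim, fun _ => rfl⟩)
  rw [Fm.sat_ex] at h'
  obtain ⟨d, hd⟩ := h'
  refine ⟨d, fun f => ?_⟩
  exact (Fm.sat_and _ _ _).1 (hd f)

theorem exists_mu : ∃ m : M.C Ty.two, ∀ f : M.C Ty.one,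
    (∃ x, f ⋄ x = M.zero) → f ⋄ (m ⋄ f) = M.zero := by
  have h := IsMuModel.mu (M := M)
  simpa [muAxiom] using h

/-! ### Definable functions and arithmetical predicates -/

/-- Functions of several variables that are given by terms with parameters. -/
class inductive Dfn {Γ : Ctx} : {τ : Ty} → (M.Env Γ → M.C τ) → Prop
  | const {τ : Ty} (c : M.C τ) : Dfn (fun _ => c)
  | var {τ : Ty} (x : Var Γ τ) : Dfn (fun e => e x)
  | app {ρ τ : Ty} {f : M.Env Γ → M.C (ρ ⇾ τ)} {g : M.Env Γ → M.C ρ} :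
      Dfn f → Dfn g → Dfn (fun e => f e ⋄ g e)

/-- Predicates with a definable characteristic function. -/
class DfnP {Γ : Ctx} (P : M.Env Γ → Prop) : Prop where
  exists_char : ∃ f : M.Env Γ → M.C Ty.nat, Dfn f ∧
    ∀ e, (P e → f e = M.zero) ∧ (¬ P e → f e = M.one)

section Definability

variable {Γ : Ctx}

instance Dfn.instConst {τ : Ty} (c : M.C τ) : Dfn (Γ := Γ) (fun _ => c) := .const c

instance Dfn.instVar {τ : Ty} (x : Var Γ τ) : Dfn (fun e : M.Env Γ => e x) := .var x

instance Dfn.instApp {ρ τ : Ty} (f : M.Env Γ → M.C (ρ ⇾ τ)) (g : M.Env Γ → M.C ρ)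
    [hf : Dfn f] [hg : Dfn g] : Dfn (fun e => f e ⋄ g e) := .app hf hg

theorem Dfn.weaken {M : Str} {Γ : Ctx} (σ : Ty) {τ : Ty} (f : M.Env Γ → M.C τ) [hf : Dfn f] :
    Dfn (fun e : M.Env (σ :: Γ) => f (fun _ x => e (.s x))) := by
  induction hf with
  | const c => exact .const c
  | var x => exact .var x.s
  | app _ _ ihf ihg => exact .app ihf ihg

/-- Combinatory completeness: bracket abstraction with `Π` and `Σ`, carried out on definable
functions with parameters from the model. -/
theorem Dfn.exists_lam {ρ τ : Ty} {f : M.Env (ρ :: Γ) → M.C τ} (hf : Dfn f) :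
    ∃ g : M.Env Γ → M.C (ρ ⇾ τ), Dfn g ∧ ∀ e a, g e ⋄ a = f (.cons a e) := by
  induction hf with
  | const c => exact ⟨fun _ => M.combPi _ _ ⋄ c, inferInstance, fun e a => by simp⟩
  | var x =>
    cases x with
    | z =>
      refine ⟨fun _ => M.combSigma ρ (ρ ⇾ ρ) ρ ⋄ M.combPi _ _ ⋄ M.combPi _ _, inferInstance,
        fun e a => ?_⟩
      simp [Env.cons]
    | s x => exact ⟨fun e => M.combPi _ _ ⋄ e x, inferInstance, fun e a => by simp [Env.cons]⟩
  | app _ _ ihf ihg =>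
    obtain ⟨f', hf', hf''⟩ := ihf
    obtain ⟨g', hg', hg''⟩ := ihg
    exact ⟨fun e => M.combSigma _ _ _ ⋄ f' e ⋄ g' e, inferInstance,
      fun e a => by simp [hf'', hg'']⟩

open Classical in
theorem Dfn.ite (P : M.Env Γ → Prop) (f g : M.Env Γ → M.C Ty.nat) [hP : DfnP P] [Dfn f]
    [Dfn g] : Dfn (fun e => if P e then f e else g e) := by
  obtain ⟨c, hc, hc'⟩ := hP.exists_char
  -- The recursor serves as a case distinction: at 0 it returns the base value, at 1 the value of
  -- the constant step function.
  have : (fun e => if P e then f e else g e) = fun e =>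
      M.recursor ⋄ c e ⋄ f e ⋄ (M.combPi _ Ty.nat ⋄ (M.combPi _ Ty.nat ⋄ g e)) := by
    funext e
    split_ifs with h
    · simp [(hc' e).1 h]
    · simp [(hc' e).2 h]
  rw [this]
  infer_instance

instance DfnP.eq (f g : M.Env Γ → M.C Ty.nat) [hf : Dfn f] [hg : Dfn g] :
    DfnP (fun e => f e = g e) := by
  obtain ⟨d, hd⟩ := exists_eq_decider (M := M)
  -- `p` packs two numbers into the function with value `a` at 0 and `b` at successors, as the
  -- decider expects.
  obtain ⟨p, hp⟩ : ∃ p : M.C (Ty.nat ⇾ Ty.nat ⇾ Ty.one), ∀ a b n,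
      p ⋄ a ⋄ b ⋄ n = M.recursor ⋄ n ⋄ a ⋄ (M.combPi _ Ty.nat ⋄ (M.combPi _ Ty.nat ⋄ b)) := by
    have h : Dfn (M := M) (Γ := [Ty.nat, Ty.nat, Ty.nat]) (fun e =>
      M.recursor ⋄ e .z ⋄ e (.s (.s .z)) ⋄
        (M.combPi _ Ty.nat ⋄ (M.combPi _ Ty.nat ⋄ e (.s .z)))) := inferInstance
    obtain ⟨p₁, h₁, h₁'⟩ := h.exists_lam
    obtain ⟨p₂, h₂, h₂'⟩ := h₁.exists_lam
    obtain ⟨p₃, h₃, h₃'⟩ := h₂.exists_lam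
    exact ⟨p₃ .nil, fun a b n => by rw [h₃', h₂', h₁']; rfl⟩
  refine ⟨fun e => d ⋄ (p ⋄ f e ⋄ g e), inferInstance, fun e => ?_⟩
  have := hd (p ⋄ f e ⋄ g e)
  simpa [hp] using this

theorem DfnP.congr {M : Str} {Γ : Ctx} {P Q : M.Env Γ → Prop} (hP : DfnP P)
    (h : ∀ e, Q e ↔ P e) : DfnP Q := by
  rwa [funext (fun e => propext (h e))]

instance DfnP.not (P : M.Env Γ → Prop) [hP : DfnP P] : DfnP (fun e => ¬ P e) := by
  classical
  refine ⟨_, Dfn.ite P (fun _ => M.one) (fun _ => M.zero), fun e => ?_⟩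
  by_cases h : P e <;> simp [h]

instance DfnP.and (P Q : M.Env Γ → Prop) [hP : DfnP P] [hQ : DfnP Q] :
    DfnP (fun e => P e ∧ Q e) := by
  classical
  obtain ⟨c, hc, hc'⟩ := hQ.exists_char
  refine ⟨_, Dfn.ite P c (fun _ => M.one), fun e => ?_⟩
  by_cases h : P e <;> simp [h]
  exact hc' e

instance DfnP.or (P Q : M.Env Γ → Prop) [hP : DfnP P] [hQ : DfnP Q] :
    DfnP (fun e => P e ∨ Q e) :=
  DfnP.congr (inferInstance : DfnP (fun e => ¬ (¬ P e ∧ ¬ Q e))) (fun e => by tauto)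

instance DfnP.imp (P Q : M.Env Γ → Prop) [hP : DfnP P] [hQ : DfnP Q] :
    DfnP (fun e => P e → Q e) :=
  DfnP.congr (inferInstance : DfnP (fun e => ¬ (P e ∧ ¬ Q e))) (fun e => by tauto)

instance DfnP.iff (P Q : M.Env Γ → Prop) [hP : DfnP P] [hQ : DfnP Q] :
    DfnP (fun e => P e ↔ Q e) :=
  DfnP.congr (inferInstance : DfnP (fun e => (P e → Q e) ∧ (Q e → P e))) (fun e => by tauto)

/-- Here (μ) enters: if a characteristic function has a zero, μ finds one, so existence amounts to
testing a single value. -/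
instance DfnP.ex (Q : M.Env Γ → M.C Ty.nat → Prop)
    [hQ : DfnP (fun e : M.Env (Ty.nat :: Γ) => Q (fun _ x => e (.s x)) (e .z))] :
    DfnP (fun e => ∃ a, Q e a) := by
  obtain ⟨m, hm⟩ := exists_mu (M := M)
  obtain ⟨c, hc, hc'⟩ := hQ.exists_char
  obtain ⟨g, hg, hg'⟩ := hc.exists_lam
  have hgQ : ∀ e a, g e ⋄ a = M.zero ↔ Q e a := by
    intro e a
    rw [hg']
    constructor
    · intro h
      by_contra hn
      rw [(hc' (.cons a e)).2 hn] at h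
      exact succ_ne_zero _ h
    · exact (hc' (.cons a e)).1
  refine DfnP.congr (inferInstance : DfnP (fun e => g e ⋄ (m ⋄ g e) = M.zero)) (fun e => ?_)
  constructor
  · rintro ⟨a, ha⟩
    exact hm _ ⟨a, (hgQ e a).2 ha⟩
  · intro h
    exact ⟨_, (hgQ e _).1 h⟩

instance DfnP.all (Q : M.Env Γ → M.C Ty.nat → Prop)
    [hQ : DfnP (fun e : M.Env (Ty.nat :: Γ) => Q (fun _ x => e (.s x)) (e .z))] :
    DfnP (fun e => ∀ a, Q e a) :=
  DfnP.congr (inferInstance : DfnP (fun e => ¬ ∃ a, ¬ Q e a)) (fun e => by simp)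

/-- Arithmetical comprehension. -/
theorem exists_char {ρ : Ty} (P : M.C ρ → Prop)
    [hP : DfnP (fun e : M.Env [ρ] => P (e .z))] :
    ∃ t : M.C (ρ ⇾ Ty.nat), ∀ x, (P x → t ⋄ x = M.zero) ∧ (¬ P x → t ⋄ x = M.one) := by
  obtain ⟨c, hc, hc'⟩ := hP.exists_char
  obtain ⟨g, hg, hg'⟩ := hc.exists_lam
  exact ⟨g .nil, fun x => by rw [hg']; exact hc' (.cons x .nil)⟩

/-- Arithmetical induction. -/
theorem induction (P : M.C Ty.nat → Prop) [hP : DfnP (fun e : M.Env [Ty.nat] => P (e .z))]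
    (hz : P M.zero) (hs : ∀ x, P x → P (M.succ ⋄ x)) (x : M.C Ty.nat) : P x := by
  obtain ⟨t, ht⟩ := exists_char P
  have ht' : ∀ x, t ⋄ x = M.zero ↔ P x := fun x => by
    refine ⟨fun h => by_contra fun hn => ?_, (ht x).1⟩
    rw [(ht x).2 hn] at h
    exact succ_ne_zero _ h
  rw [← ht']
  refine induction_app t ((ht' _).2 hz) (fun y hy => (ht' _).2 (hs y ((ht' _).1 hy))) x

/-- Arithmetical choice of numbers. -/
theorem exists_choice (S : M.C Ty.nat → M.C Ty.nat → M.C Ty.nat → Prop)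
    [hS : DfnP (fun e : M.Env [Ty.nat, Ty.nat, Ty.nat] =>
      S (e (.s (.s .z))) (e (.s .z)) (e .z))] :
    ∃ G : M.C (Ty.nat ⇾ Ty.nat ⇾ Ty.nat), ∀ a b, (∃ c, S a b c) → S a b (G ⋄ a ⋄ b) := by
  obtain ⟨m, hm⟩ := exists_mu (M := M)
  obtain ⟨c, hc, hc'⟩ := hS.exists_char
  obtain ⟨g, hg, hg'⟩ := hc.exists_lam
  -- The choice function is μ applied to the characteristic function of the candidates, abstracted
  -- over both parameters.
  have hmg : Dfn (fun e => m ⋄ g e) := inferInstance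
  obtain ⟨k, hk, hk'⟩ := hmg.exists_lam
  obtain ⟨l, hl, hl'⟩ := hk.exists_lam
  refine ⟨l .nil, fun a b hab => ?_⟩
  rw [hl', hk']
  have hgS : ∀ x, g (.cons b (.cons a .nil)) ⋄ x = M.zero ↔ S a b x := by
    intro x
    rw [hg']
    constructor
    · intro h
      by_contra hn
      rw [(hc' (.cons x (.cons b (.cons a .nil)))).2 hn] at h
      exact succ_ne_zero _ h
    · exact (hc' (.cons x (.cons b (.cons a .nil)))).1
  obtain ⟨x, hx⟩ := hab
  exact (hgS _).1 (hm _ ⟨x, (hgS x).2 hx⟩)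

end Definability

end Str

namespace Str

variable {M : Str} [M.IsMuModel]

/-! ### Arithmetic in a model -/

@[simp] theorem eval_lam {Γ : Ctx} {ρ τ : Ty} (t : Tm (ρ :: Γ) τ) (e : M.Env Γ) (a : M.C ρ) :
    t.lam.eval e ⋄ a = t.eval (.cons a e) := by
  induction t with
  | var x => cases x <;> simp [Tm.lam, Tm.eval, Env.cons]
  | app s t ihs iht => simp [Tm.lam, Tm.eval, ← ihs, ← iht]
  | _ => simp [Tm.lam, Tm.eval]

variable (M) in
/-- The step function of the predecessor. -/
def predStep : M.C (Ty.nat ⇾ Ty.nat ⇾ Ty.nat) :=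
  (Tm.lam (Tm.lam v0) : Tm [] _).eval .nil

def pred (x : M.C Ty.nat) : M.C Ty.nat := M.recursor ⋄ x ⋄ M.zero ⋄ M.predStep

variable (M) in
/-- The step function of truncated subtraction. -/
def monusStep : M.C (Ty.nat ⇾ Ty.nat ⇾ Ty.nat) :=
  (Tm.lam (Tm.lam (Tm.pred v1)) : Tm [] _).eval .nil

/-- Truncated subtraction. -/
def monus (x y : M.C Ty.nat) : M.C Ty.nat := M.recursor ⋄ y ⋄ x ⋄ M.monusStep

variable (M) in
/-- The step function of addition. -/
def addStep : M.C (Ty.nat ⇾ Ty.nat ⇾ Ty.nat) :=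
  (Tm.lam (Tm.lam (.succ ⬝ v1)) : Tm [] _).eval .nil

def add (x y : M.C Ty.nat) : M.C Ty.nat := M.recursor ⋄ y ⋄ x ⋄ M.addStep

theorem eval_pred {Γ : Ctx} (s : Tm Γ Ty.nat) (e : M.Env Γ) :
    s.pred.eval e = pred (s.eval e) := by
  have : (Tm.lam (Tm.lam v0) : Tm Γ (Ty.nat ⇾ Ty.nat ⇾ Ty.nat)).eval e = M.predStep :=
    app_ext fun x => app_ext fun y => by simp [predStep]
  simp [Tm.pred, pred, ← this, Tm.eval]

@[simp] theorem pred_zero : pred (M.zero) = M.zero := by simp [pred]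

@[simp] theorem pred_succ (x : M.C Ty.nat) : pred (M.succ ⋄ x) = x := by simp [pred, predStep]

theorem eval_monus {Γ : Ctx} (s t : Tm Γ Ty.nat) (e : M.Env Γ) :
    (s.monus t).eval e = monus (s.eval e) (t.eval e) := by
  have : (Tm.lam (Tm.lam (Tm.pred v1)) : Tm Γ (Ty.nat ⇾ Ty.nat ⇾ Ty.nat)).eval e =
      M.monusStep :=
    app_ext fun x => app_ext fun y => by simp [monusStep, eval_pred]
  simp [Tm.monus, monus, ← this, Tm.eval]

@[simp] theorem monus_zero (x : M.C Ty.nat) : monus x M.zero = x := by simp [monus]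

theorem monus_succ (x y : M.C Ty.nat) : monus x (M.succ ⋄ y) = pred (monus x y) := by
  simp [monus, monusStep, eval_pred]

theorem eval_add {Γ : Ctx} (s t : Tm Γ Ty.nat) (e : M.Env Γ) :
    (s.add t).eval e = add (s.eval e) (t.eval e) := by
  have : (Tm.lam (Tm.lam (.succ ⬝ v1)) : Tm Γ (Ty.nat ⇾ Ty.nat ⇾ Ty.nat)).eval e =
      M.addStep :=
    app_ext fun x => app_ext fun y => by simp [addStep]
  simp [Tm.add, add, ← this, Tm.eval]

@[simp] theorem add_zero (x : M.C Ty.nat) : add x M.zero = x := by simp [add]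

@[simp] theorem add_succ (x y : M.C Ty.nat) : add x (M.succ ⋄ y) = M.succ ⋄ add x y := by
  simp [add, addStep]

instance Dfn.monus {Γ : Ctx} (f g : M.Env Γ → M.C Ty.nat) [Dfn f] [Dfn g] :
    Dfn (fun e => monus (f e) (g e)) := by
  unfold Str.monus
  infer_instance

theorem eq_zero_or_succ (x : M.C Ty.nat) : x = M.zero ∨ ∃ y, x = M.succ ⋄ y :=
  induction (fun x => x = M.zero ∨ ∃ y, x = M.succ ⋄ y) (Or.inl rfl)
    (fun x _ => Or.inr ⟨x, rfl⟩) x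

@[simp] theorem succ_monus_succ (x y : M.C Ty.nat) :
    monus (M.succ ⋄ x) (M.succ ⋄ y) = monus x y := by
  refine induction (fun y => monus (M.succ ⋄ x) (M.succ ⋄ y) = monus x y) ?_ ?_ y
  · simp [monus_succ]
  · intro y hy
    rw [monus_succ, hy, monus_succ]

@[simp] theorem zero_monus (x : M.C Ty.nat) : monus M.zero x = M.zero := by
  refine induction (fun x => monus M.zero x = M.zero) (by simp) ?_ x
  intro x hx
  rw [monus_succ, hx, pred_zero]

@[simp] theorem succ_monus_self (x : M.C Ty.nat) : monus (M.succ ⋄ x) x = M.one := by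
  refine induction (fun x => monus (M.succ ⋄ x) x = M.one) (by simp) ?_ x
  intro x hx
  rw [succ_monus_succ, hx]

/-- The order of the numbers of a model. -/
def lt (x y : M.C Ty.nat) : Prop := monus (M.succ ⋄ x) y = M.zero

instance DfnP.lt {Γ : Ctx} (f g : M.Env Γ → M.C Ty.nat) [Dfn f] [Dfn g] :
    DfnP (fun e => lt (f e) (g e)) := by
  unfold Str.lt
  infer_instance

theorem sat_lt {Γ : Ctx} (s t : Tm Γ Ty.nat) (e : M.Env Γ) :
    (Fm.lt s t).Sat e ↔ lt (s.eval e) (t.eval e) := by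
  simp [Fm.lt, eval_monus, lt]

theorem not_lt_zero (x : M.C Ty.nat) : ¬ lt x M.zero := by simp [lt]

theorem zero_lt_succ (x : M.C Ty.nat) : lt M.zero (M.succ ⋄ x) := by simp [lt]

theorem succ_lt_succ {x y : M.C Ty.nat} : lt (M.succ ⋄ x) (M.succ ⋄ y) ↔ lt x y := by simp [lt]

theorem lt_succ_of_lt {x y : M.C Ty.nat} (h : lt x y) : lt x (M.succ ⋄ y) := by
  unfold lt at h ⊢
  rw [monus_succ, h, pred_zero]

theorem lt_trichotomy (x y : M.C Ty.nat) : lt x y ∨ x = y ∨ lt y x := by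
  -- The other number stays quantified because it must be lowered along with `y`; arithmetical
  -- induction permits this.
  refine induction (fun y => ∀ x, lt x y ∨ x = y ∨ lt y x) ?_ ?_ y x
  · intro x
    rcases eq_zero_or_succ x with rfl | ⟨x, rfl⟩
    · exact Or.inr (Or.inl rfl)
    · exact Or.inr (Or.inr (zero_lt_succ x))
  · intro y ih x
    rcases eq_zero_or_succ x with rfl | ⟨x, rfl⟩
    · exact Or.inl (zero_lt_succ y)
    · simpa [succ_lt_succ] using ih x

theorem lt_succ_iff {x y : M.C Ty.nat} : lt x (M.succ ⋄ y) ↔ lt x y ∨ x = y := by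
  constructor
  · intro h
    rcases lt_trichotomy x y with h' | h' | h'
    · exact Or.inl h'
    · exact Or.inr h'
    · exfalso
      refine induction (fun y => ∀ x, lt x (M.succ ⋄ y) → ¬ lt y x) ?_ ?_ y x h h'
      · intro x h h'
        rcases eq_zero_or_succ x with rfl | ⟨x, rfl⟩
        · exact not_lt_zero _ h'
        · exact not_lt_zero _ (succ_lt_succ.1 h)
      · intro y ih x h h'
        rcases eq_zero_or_succ x with rfl | ⟨x, rfl⟩
        · exact not_lt_zero _ h'
        · exact ih x (succ_lt_succ.1 h) (succ_lt_succ.1 h')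
  · rintro (h | rfl)
    · exact lt_succ_of_lt h
    · simp only [lt, succ_monus_succ]
      refine induction (fun x => monus x x = M.zero) (by simp) (fun x hx => ?_) x
      rwa [succ_monus_succ]

theorem lt_succ_self (x : M.C Ty.nat) : lt x (M.succ ⋄ x) := lt_succ_iff.2 (Or.inr rfl)

theorem lt_trans {x y z : M.C Ty.nat} (hxy : lt x y) (hyz : lt y z) : lt x z := by
  refine induction (fun z => ∀ y, lt x y → lt y z → lt x z) ?_ ?_ z y hxy hyz
  · exact fun y _ h => (not_lt_zero y h).elim
  · intro z ih y hxy hyz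
    rcases lt_succ_iff.1 hyz with h | rfl
    · exact lt_succ_of_lt (ih y hxy h)
    · exact lt_succ_of_lt hxy

/-- Any two numbers have an upper bound. -/
theorem exists_bound (x y : M.C Ty.nat) : ∃ m, (∀ z, lt m z → lt x z ∧ lt y z) ∧
    lt x (M.succ ⋄ m) ∧ lt y (M.succ ⋄ m) := by
  rcases lt_trichotomy x y with h | rfl | h
  · exact ⟨y, fun z hz => ⟨lt_trans h hz, hz⟩, lt_succ_of_lt h, lt_succ_self y⟩
  · exact ⟨x, fun z hz => ⟨hz, hz⟩, lt_succ_self x, lt_succ_self x⟩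
  · exact ⟨x, fun z hz => ⟨hz, lt_trans h hz⟩, lt_succ_self x, lt_succ_of_lt h⟩

/-! ### Sets in a model -/

/-- `n ∈ X` -/
def elt (n : M.C Ty.nat) (X : M.C Ty.one) : Prop := X ⋄ n = M.zero

instance DfnP.elt {Γ : Ctx} (f : M.Env Γ → M.C Ty.nat) (g : M.Env Γ → M.C Ty.one)
    [Dfn f] [Dfn g] : DfnP (fun e => elt (f e) (g e)) := by
  unfold Str.elt
  infer_instance

/-- `X` and `Y` have the same elements. -/
def setEq (X Y : M.C Ty.one) : Prop := ∀ n, elt n X ↔ elt n Y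

instance DfnP.setEq {Γ : Ctx} (f g : M.Env Γ → M.C Ty.one)
    [Dfn f] [Dfn g] : DfnP (fun e => setEq (f e) (g e)) := by
  have := Dfn.weaken Ty.nat f
  have := Dfn.weaken Ty.nat g
  unfold Str.setEq
  infer_instance

def inter (X Y : M.C Ty.one) : M.C Ty.one := (Tm.inter v0 v1).eval (.cons X (.cons Y .nil))

def compl (X : M.C Ty.one) : M.C Ty.one := (Tm.compl v0).eval (.cons X .nil)

def normalize (X : M.C Ty.one) : M.C Ty.one := (Tm.normalize v0).eval (.cons X .nil)

theorem eval_inter {Γ : Ctx} (s t : Tm Γ Ty.one) (e : M.Env Γ) :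
    (s.inter t).eval e = inter (s.eval e) (t.eval e) :=
  app_ext fun x => by simp [inter, Tm.inter, Tm.max, eval_add, eval_monus]

theorem eval_compl {Γ : Ctx} (s : Tm Γ Ty.one) (e : M.Env Γ) :
    s.compl.eval e = compl (s.eval e) :=
  app_ext fun x => by simp [compl, Tm.compl, Tm.num1, eval_monus]

theorem eval_normalize {Γ : Ctx} (s : Tm Γ Ty.one) (e : M.Env Γ) :
    s.normalize.eval e = normalize (s.eval e) :=
  app_ext fun x => by simp [normalize, Tm.normalize, Tm.min, Tm.num1, eval_monus]

@[simp] theorem elt_inter {n : M.C Ty.nat} {X Y : M.C Ty.one} :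
    elt n (inter X Y) ↔ elt n X ∧ elt n Y := by
  simp only [elt, inter, Tm.inter, Tm.max, eval_lam, eval_add, eval_monus, Tm.eval_app,
    Tm.eval_up, eval_v0, eval_v1]
  rcases eq_zero_or_succ (X ⋄ n) with h | ⟨x, h⟩ <;>
  rcases eq_zero_or_succ (Y ⋄ n) with h' | ⟨y, h'⟩ <;> rw [h, h'] <;> simp
  rcases eq_zero_or_succ (monus y x) with h'' | ⟨z, h''⟩ <;> rw [h''] <;> simp

@[simp] theorem elt_compl {n : M.C Ty.nat} {X : M.C Ty.one} :
    elt n (compl X) ↔ ¬ elt n X := by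
  simp only [elt, compl, Tm.compl, Tm.num1, eval_lam, eval_monus, Tm.eval_app, Tm.eval_succ,
    Tm.eval_zero, Tm.eval_up, eval_v0]
  rcases eq_zero_or_succ (X ⋄ n) with h | ⟨x, h⟩ <;> rw [h] <;> simp

@[simp] theorem elt_normalize {n : M.C Ty.nat} {X : M.C Ty.one} :
    elt n (normalize X) ↔ elt n X := by
  simp only [elt, normalize, Tm.normalize, Tm.min, Tm.num1, eval_lam, eval_monus, Tm.eval_app,
    Tm.eval_succ, Tm.eval_zero, Tm.eval_up, eval_v0]
  rcases eq_zero_or_succ (X ⋄ n) with h | ⟨x, h⟩ <;> rw [h] <;> simp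

theorem setEq_refl {M : Str} (X : M.C Ty.one) : setEq X X := fun _ => Iff.rfl

/-- `X` is infinite. -/
def infinite (X : M.C Ty.one) : Prop := ∀ n, ∃ k, lt n k ∧ elt k X

/-- `X` is a member of the sequence `A`. -/
def memSeq (X : M.C Ty.one) (A : M.C Ty.seq) : Prop := ∃ i, setEq X (A ⋄ i)

instance DfnP.memSeq {Γ : Ctx} (f : M.Env Γ → M.C Ty.one) (g : M.Env Γ → M.C Ty.seq)
    [Dfn f] [Dfn g] : DfnP (fun e => memSeq (f e) (g e)) := by
  have := Dfn.weaken Ty.nat f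
  have := Dfn.weaken Ty.nat g
  unfold Str.memSeq
  infer_instance

end Str

namespace Str

variable {M : Str} [M.IsMuModel]

/-! ### Branches of the tree -/

/-- `z` and `w` belong to the same sets among `B_i` with `i < n`. -/
abbrev Agree (B : M.C Ty.seq) (n w z : M.C Ty.nat) : Prop :=
  ∀ i, lt i n → (elt z (B ⋄ i) ↔ elt w (B ⋄ i))

/-- The pattern of length `n` that `w` realizes in the sequence `B` belongs to the tree: it is
realized by infinitely many elements of each `F_j`. Every node of the tree is of this form, so that
numbers can serve as codes for the nodes. -/
abbrev Node (B F : M.C Ty.seq) (n w : M.C Ty.nat) : Prop :=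
  ∀ j y, ∃ z, lt y z ∧ elt z (F ⋄ j) ∧ Agree B n w z

/-- Closure of F under intersections forces one of the two signs for the next set to work for all
`j` and `y` at once. -/
theorem Node.exists_succ {B F : M.C Ty.seq}
    (hF : ∀ i j, ∃ k, setEq (inter (F ⋄ i) (F ⋄ j)) (F ⋄ k)) {n w : M.C Ty.nat}
    (h : Node B F n w) : ∃ w', Agree B n w w' ∧ Node B F (M.succ ⋄ n) w' := by
  have key : ∃ c : Prop, ∀ j y, ∃ z, lt y z ∧ elt z (F ⋄ j) ∧ Agree B n w z ∧
      (elt z (B ⋄ n) ↔ c) := by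
    by_contra! hc
    obtain ⟨j₁, y₁, h₁⟩ := hc True
    obtain ⟨j₂, y₂, h₂⟩ := hc False
    obtain ⟨k, hk⟩ := hF j₁ j₂
    obtain ⟨m, hm, -⟩ := exists_bound y₁ y₂
    obtain ⟨z, hz, hzk, hzw⟩ := h k m
    -- This `z` lies in both members of F and beyond both bounds, so it would have to be neither in
    -- nor outside the next set.
    have hz' := elt_inter.1 ((hk z).2 hzk)
    have h₁ := h₁ z (hm z hz).1 hz'.1 hzw
    have h₂ := h₂ z (hm z hz).2 hz'.2 hzw
    tauto
  obtain ⟨c, hc⟩ := key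
  obtain ⟨w', -, -, hw', hcw'⟩ := hc M.zero M.zero
  refine ⟨w', hw', fun j y => ?_⟩
  obtain ⟨z, hyz, hzj, hz, hcz⟩ := hc j y
  refine ⟨z, hyz, hzj, fun i hi => ?_⟩
  rcases lt_succ_iff.1 hi with hi | rfl
  · exact (hz i hi).trans (hw' i hi).symm
  · exact hcz.trans hcw'.symm

/-- The tree has an infinite branch. -/
theorem exists_branch {B F : M.C Ty.seq}
    (hF : ∀ i j, ∃ k, setEq (inter (F ⋄ i) (F ⋄ j)) (F ⋄ k))
    (hinf : ∀ j, infinite (F ⋄ j)) :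
    ∃ b : M.C Ty.one, (∀ i, b ⋄ i = M.zero ∨ b ⋄ i = M.one) ∧
      ∀ n j y, ∃ z, lt y z ∧ elt z (F ⋄ j) ∧
        ∀ i, lt i n → (elt z (B ⋄ i) ↔ b ⋄ i = M.zero) := by
  -- `G` sends the code of a node and its length to the code of an extension by one; the argument
  -- order is that of a step function of the recursor.
  obtain ⟨G, hG⟩ := exists_choice (M := M)
    (fun w n w' => Agree B n w w' ∧ Node B F (M.succ ⋄ n) w')
  -- The starting code 0 is arbitrary: a pattern of length 0 imposes no condition.
  let code (n : M.C Ty.nat) : M.C Ty.nat := M.recursor ⋄ n ⋄ M.zero ⋄ G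
  have hcode : ∀ n, code (M.succ ⋄ n) = G ⋄ code n ⋄ n := fun n => recursor_succ _ _ _
  have hnode : ∀ n, Node B F n (code n) := by
    refine induction (fun n => Node B F n (M.recursor ⋄ n ⋄ M.zero ⋄ G)) ?_ ?_
    · intro j y
      obtain ⟨z, hz, hzj⟩ := hinf j y
      exact ⟨z, hz, hzj, fun i hi => (not_lt_zero i hi).elim⟩
    · intro n hn
      change Node B F _ (code (M.succ ⋄ n))
      rw [hcode]
      exact (hG _ _ (Node.exists_succ hF hn)).2
  have hagree : ∀ n, Agree B n (code n) (code (M.succ ⋄ n)) := fun n => by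
    rw [hcode]
    exact (hG _ _ (Node.exists_succ hF (hnode n))).1
  -- The sign at `i` is first fixed by the node of length `i + 1`; later codes agree with it.
  obtain ⟨b, hb⟩ := exists_char (fun i => elt (M.recursor ⋄ (M.succ ⋄ i) ⋄ M.zero ⋄ G) (B ⋄ i))
  have hb₀ : ∀ i, elt (code (M.succ ⋄ i)) (B ⋄ i) ↔ b ⋄ i = M.zero := fun i => by
    refine ⟨(hb i).1, fun h => by_contra fun hn => ?_⟩
    rw [(hb i).2 hn] at h
    exact succ_ne_zero _ h
  have hcb : ∀ n i, lt i n → (elt (code n) (B ⋄ i) ↔ b ⋄ i = M.zero) := by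
    refine induction (fun n => ∀ i, lt i n →
      (elt (M.recursor ⋄ n ⋄ M.zero ⋄ G) (B ⋄ i) ↔ b ⋄ i = M.zero)) ?_ ?_
    · exact fun i hi => (not_lt_zero i hi).elim
    · intro n hn i hi
      rcases lt_succ_iff.1 hi with hi | rfl
      · exact (hagree n i hi).trans (hn i hi)
      · exact hb₀ i
  refine ⟨b, fun i => ?_, fun n j y => ?_⟩
  · by_cases h : elt (code (M.succ ⋄ i)) (B ⋄ i)
    · exact Or.inl ((hb i).1 h)
    · exact Or.inr ((hb i).2 h)
  · obtain ⟨z, hz, hzj, hzn⟩ := hnode n j y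
    exact ⟨z, hz, hzj, fun i hi => (hzn i hi).trans (hcb n i hi)⟩

/-! ### Semantics of the notions about collections of sets -/

section Collections

variable {M : Str} {Γ : Ctx} (e : M.Env Γ)

theorem sat_elt (s : Tm Γ Ty.nat) (X : Tm Γ Ty.one) :
    (Fm.elt s X).Sat e ↔ elt (s.eval e) (X.eval e) := Iff.rfl

theorem sat_setEq (X Y : Tm Γ Ty.one) :
    (Fm.setEq X Y).Sat e ↔ setEq (X.eval e) (Y.eval e) := by
  simp [Fm.setEq, setEq, sat_elt]

theorem sat_infinite [M.IsMuModel] (X : Tm Γ Ty.one) :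
    (Fm.infinite X).Sat e ↔ infinite (X.eval e) := by
  simp [Fm.infinite, infinite, sat_elt, sat_lt]

theorem sat_mem_enum (X : Tm Γ Ty.one) (A : Tm Γ Ty.seq) :
    (Fm.mem X (.enum A)).Sat e ↔ memSeq (X.eval e) (A.eval e) := by
  simp [Fm.mem, memSeq, sat_setEq]

theorem sat_mem_char (X : Tm Γ Ty.one) (U : Tm Γ Ty.two) :
    (Fm.mem X (.char U)).Sat e ↔ U.eval e ⋄ X.eval e = M.zero := by
  simp [Fm.mem]

end Collections

/-! ### The extended ultrafilter in a model -/

theorem sat_extensionSentence : extensionSentence.Sat (Env.nil (M := M)) := by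
  simp only [extensionSentence, Fm.sat_all, Fm.sat_imp, Fm.sat_and, Fm.sat_or, Fm.sat_ex,
    Fm.sat_iff, Fm.sat_eq,
    Fm.algebra, Fm.partialUltrafilter, Fm.subColl, Fm.branch, Fm.generated, Fm.wellDefined,
    Coll.up, sat_mem_enum, sat_mem_char, sat_elt, sat_setEq, sat_infinite, sat_lt,
    eval_inter, eval_compl, eval_normalize, Tm.num1,
    Tm.eval_app, Tm.eval_up, Tm.eval_zero, Tm.eval_succ, eval_v0, eval_v1, eval_v2, eval_v3,
    eval_v4]
  rintro A F ⟨-, hFA, -, -, hFinter, hFinf, -⟩ B ⟨⟨hBcompl, -, hBinter⟩, hAB⟩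
  have hFF : ∀ j, memSeq (F ⋄ j) F := fun j => ⟨j, setEq_refl _⟩
  obtain ⟨b, hb01, hb⟩ := exists_branch (B := B) (F := F)
    (fun i j => hFinter _ _ ⟨hFA _ (hFF i), hFA _ (hFF j)⟩ ⟨hFF i, hFF j⟩)
    (fun j => hFinf _ (hFA _ (hFF j)) (hFF j))
  let P (X : M.C Ty.one) : Prop := memSeq X F ∨ ∃ i, b ⋄ i = M.zero ∧ setEq X (B ⋄ i)
  obtain ⟨U, hU⟩ := exists_char (M := M)
    (fun X => memSeq X F ∨ ∃ i, b ⋄ i = M.zero ∧ setEq X (B ⋄ i))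
  have hUP : ∀ X, U ⋄ X = M.zero ↔ P X := fun X => by
    refine ⟨fun h => by_contra fun hn => ?_, (hU X).1⟩
    rw [(hU X).2 hn] at h
    exact succ_ne_zero _ h
  have hb₂ : ∀ i j k y, ∃ z, lt y z ∧ elt z (F ⋄ j) ∧
      (elt z (B ⋄ i) ↔ b ⋄ i = M.zero) ∧ (elt z (B ⋄ k) ↔ b ⋄ k = M.zero) := fun i j k y => by
    obtain ⟨m, -, him, hkm⟩ := exists_bound i k
    obtain ⟨z, hyz, hzj, hz⟩ := hb (M.succ ⋄ m) j y
    exact ⟨z, hyz, hzj, hz i him, hz k hkm⟩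
  -- The pivot of the verification: membership is governed by the branch at any index of the set. If
  -- the set is some F_j, a realizer taken from F_j forces the sign; if it recurs at another index,
  -- a realizer of both signs shows that they agree.
  have hPb : ∀ {X i}, setEq X (B ⋄ i) → (U ⋄ X = M.zero ↔ b ⋄ i = M.zero) := by
    intro X i hX
    rw [hUP]
    constructor
    · rintro (⟨j, hj⟩ | ⟨k, hk, hXk⟩)
      · obtain ⟨z, -, hzj, hz, -⟩ := hb₂ i j i M.zero
        exact hz.1 ((hX z).1 ((hj z).2 hzj))
      · obtain ⟨z, -, -, hzi, hzk⟩ := hb₂ i M.zero k M.zero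
        exact hzi.1 ((hX z).1 ((hXk z).2 (hzk.2 hk)))
    · exact fun h => Or.inr ⟨i, h, hX⟩
  refine ⟨b, U, ⟨?_, ?_, ?_, ?_, ?_, ?_⟩, fun X hX => (hUP X).2 (Or.inl hX), ⟨hb01, hb⟩, hUP⟩
  · intro X hX
    rcases (hUP X).1 hX with h | ⟨i, -, h⟩
    · exact hAB X (hFA X h)
    · exact ⟨i, h⟩
  · intro X hX
    obtain ⟨k, hk⟩ := hBcompl X hX
    obtain ⟨i, hi⟩ := hX
    rw [hPb hi, hPb hk]
    obtain ⟨z, -, -, hzi, hzk⟩ := hb₂ i M.zero k M.zero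
    have h₁ := hi z
    have h₂ := hk z
    rw [elt_compl] at h₂
    tauto
  · rintro X Y ⟨hX, hY⟩ h
    obtain ⟨k, hk⟩ := hBinter X Y ⟨hX, hY⟩
    obtain ⟨l, hl⟩ := hY
    rw [hPb hk] at h
    rw [hPb hl]
    obtain ⟨z, -, -, hzk, hzl⟩ := hb₂ k M.zero l M.zero
    exact hzl.1 ((hl z).1 (elt_inter.1 ((hk z).2 (hzk.2 h))).2)
  · rintro X Y ⟨hX, hY⟩ ⟨h, h'⟩
    obtain ⟨k, hk⟩ := hBinter X Y ⟨hX, hY⟩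
    obtain ⟨i, hi⟩ := hX
    obtain ⟨l, hl⟩ := hY
    rw [hPb hi] at h
    rw [hPb hl] at h'
    rw [hPb hk]
    obtain ⟨m, -, him, hlm⟩ := exists_bound i l
    -- Three signs must be realized at once, those of both sets and of their intersection, so the
    -- bound is taken twice.
    obtain ⟨m', -, hmm', hkm'⟩ := exists_bound (M.succ ⋄ m) k
    obtain ⟨z, -, -, hz⟩ := hb (M.succ ⋄ m') M.zero M.zero
    refine (hz k hkm').1 ((hk z).1 (elt_inter.2 ⟨?_, ?_⟩))
    · exact (hi z).2 ((hz i (lt_trans him hmm')).2 h)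
    · exact (hl z).2 ((hz l (lt_trans hlm hmm')).2 h')
  · rintro X ⟨i, hi⟩ h y
    rw [hPb hi] at h
    obtain ⟨z, hyz, -, hz, -⟩ := hb₂ i M.zero i y
    exact ⟨z, hyz, (hi z).2 (hz.2 h)⟩
  · intro X
    have hX : ∀ Y, setEq X Y ↔ setEq (normalize X) Y := fun Y => by simp [setEq]
    have hP : P X ↔ P (normalize X) := by simp only [P, memSeq, hX]
    by_cases h : P X
    · rw [(hU X).1 h, (hU _).1 (hP.1 h)]
    · rw [(hU X).2 h, (hU _).2 (fun h' => h (hP.2 h'))]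

end Str

/-! ### From models back to derivability -/

theorem RCA.hasEq : Theory.HasEq RCA :=
  ⟨fun _ => RCA.refl, fun _ => RCA.symm, fun _ => RCA.trans, fun _ _ _ => RCA.ext⟩

theorem Der.mono {T T' : Theory} (hT : ∀ ⦃Γ : Ctx⦄ (A : Fm Γ), T A → T' A) {Γ : Ctx}
    {H : List (Fm Γ)} {A : Fm Γ} (h : Der T H A) : Der T' H A := by
  induction h with
  | ax h => exact .ax (hT _ h)
  | hyp h => exact .hyp h
  | impI _ ih => exact .impI ih
  | impE _ _ ih₁ ih₂ => exact .impE ih₁ ih₂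
  | raa _ ih => exact .raa ih
  | allI _ ih => exact .allI ih
  | allE _ t ih => exact .allE ih t

end FinTypes

/-- `RCA₀^ω + (μ)` proves that every countable partial non-principal ultrafilter for a countable
algebra extends to a partial non-principal ultrafilter for any countable extension of it. -/
theorem mainTheorem4 :
    (FinTypes.RCA.Plus FinTypes.muAxiom).Proves FinTypes.extensionSentence := by
  open FinTypes in
  -- Completeness needs a theory closed under substitution. `RCA` is one, but `Plus` adds its
  -- sentence only in the empty context; so (μ) is first an open assumption and is discharged
  -- afterwards.
  have h : Der RCA [muAxiom] extensionSentence :=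
    der_of_models RCA.subClosed RCA.hasEq fun M hext hrca hmu =>
      have : M.IsMuModel := ⟨hext, hrca, hmu _ List.mem_cons_self⟩
      Str.sat_extensionSentence
  exact .impE (.impI (h.mono fun _ _ => .old)) (.ax .new)
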